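/- A lattice is a finitely generated $\mathbb Z$-submodule $L$ of a finite-dimensional positive definite quadratic space over $\mathbb Q$ with quadratic map $Q$ and symmetric bilinear form $B$, $B(x,x)=Q(x)$; it is integral if $B(x,y)\in\mathbb Z$ for all $x,y\in L$. A lattice $L$ represents a lattice $M$ if there is a $\mathbb Z$-linear map $\sigma:M\to L$ with $Q(\sigma(x))=Q(x)$ for all $x\in M$; $L$ and $M$ are isometric if there is a bijective such map. Write $\mathrm{cls}(L)$ for the isometry class of $L$; a lattice represents a class if it represents the lattices in it. For a positive integer $n$, let $\Phi_n$ be the set of isometry classes of integral lattices of rank $n$. An $n$-exceptional set is a set of the form $\mathcal E_n(L)=\{c\in\Phi_n : L \text{ does not represent } c\}$ for some integral lattice $L$ of rank at least $n$. A $\Phi_n$-universality criterion set is a finite subset $\mathcal X\subseteq\Phi_n$ such that every integral lattice which represents all classes in $\mathcal X$ represents all classes in $\Phi_n$. **Proposition.** Let $n$ be a positive integer and let $N$ be an integral lattice of rank $n$. Then $\{\mathrm{cls}(N)\}$ is an $n$-exceptional set if and only if every $\Phi_n$-universality criterion set contains $\mathrm{cls}(N)$. -/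

import Mathlib

/-- A lattice: a finitely generated `ℤ`-submodule `L` of a finite dimensional positive definite
quadratic space `(V, Q)` over `ℚ`. (The submodule is not required to span `V`; rank, integrality,
representations and isometry classes below only depend on `L` and on `Q` restricted to `L`.) -/
structure QLattice where
  /-- The ambient rational vector space. -/
  V : Type
  [instAddCommGroup : AddCommGroup V]
  [instModule : Module ℚ V]
  [instFiniteDimensional : FiniteDimensional ℚ V]
  /-- The quadratic map on the ambient space. -/
  Q : QuadraticForm ℚ V
  posDef : Q.PosDef
  /-- The lattice itself. -/
  L : Submodule ℤ V
  fg : L.FG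

namespace QLattice

attribute [instance] instAddCommGroup instModule instFiniteDimensional

/-- The symmetric bilinear form with `B x x = Q x`. -/
noncomputable def B (M : QLattice) : LinearMap.BilinForm ℚ M.V :=
  QuadraticMap.associated M.Q

/-- The scale: the `ℤ`-submodule of `ℚ` generated by all `B x y` with `x`, `y` in the lattice. -/
def scale (M : QLattice) : Submodule ℤ ℚ :=
  Submodule.span ℤ {b : ℚ | ∃ x ∈ M.L, ∃ y ∈ M.L, M.B x y = b}

/-- A lattice is integral if its scale is contained in `ℤ`. -/
def IsIntegral (M : QLattice) : Prop :=
  M.scale ≤ LinearMap.range (Algebra.linearMap ℤ ℚ)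

/-- The rank of the `ℤ`-module underlying the lattice. -/
noncomputable def rank (M : QLattice) : ℕ :=
  Module.finrank ℤ M.L

/-- The quadratic map `Q` restricted to the lattice. -/
def form (M : QLattice) : QuadraticMap ℤ M.L ℚ :=
  (M.Q.restrictScalars (S := ℤ)).comp M.L.subtype

theorem form_apply (M : QLattice) (x : M.L) : M.form x = M.Q (x : M.V) := rfl

/-- `K` is represented by `M`: there is a linear map `σ : K → M` with `Q (σ x) = Q x`. -/
def Represents (M K : QLattice) : Prop :=
  Nonempty (K.form →qᵢ M.form)

/-- Isometry of lattices: a bijective linear map preserving `Q`. (It extends uniquely to an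
isometry of the spanned quadratic spaces carrying one lattice onto the other.) -/
def Isometric (M K : QLattice) : Prop :=
  M.form.Equivalent K.form

end QLattice

/-- Integral (positive definite) lattices. -/
abbrev IntegralLattice : Type 1 := {M : QLattice // M.IsIntegral}

/-- Isometry as an equivalence relation on integral lattices. -/
instance integralLatticeSetoid : Setoid IntegralLattice where
  r M K := M.1.Isometric K.1
  iseqv :=
    ⟨fun _ => QuadraticMap.Equivalent.refl _, fun h => QuadraticMap.Equivalent.symm h,
      fun h h' => QuadraticMap.Equivalent.trans h h'⟩

/-- Isometry classes of integral lattices. -/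
abbrev LatticeClass : Type 1 := Quotient integralLatticeSetoid

/-- The isometry class containing `M`. -/
def cls (M : IntegralLattice) : LatticeClass := Quotient.mk _ M

/-- `M` represents the class `c`, i.e. represents a lattice in that class. -/
def RepresentsClass (M : IntegralLattice) (c : LatticeClass) : Prop :=
  ∃ K : IntegralLattice, cls K = c ∧ M.1.Represents K.1

theorem cls_eq_iff (M K : IntegralLattice) : cls M = cls K ↔ M.1.Isometric K.1 :=
  Quotient.eq

/-- Whether a class is represented does not depend on the chosen lattice in it. -/
theorem representsClass_cls (M K : IntegralLattice) :
    RepresentsClass M (cls K) ↔ M.1.Represents K.1 := by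
  constructor
  · rintro ⟨K', h, ⟨σ⟩⟩
    obtain ⟨e⟩ := (cls_eq_iff K' K).1 h
    exact ⟨σ.comp e.symm.toIsometry⟩
  · exact fun h => ⟨K, rfl, h⟩

/-- `Φ_n`: the set of classes of integral lattices of rank `n`. -/
def Phi (n : ℕ) : Set LatticeClass :=
  {c | ∃ K : IntegralLattice, K.1.rank = n ∧ cls K = c}

/-- The `n`-exceptional set of `M`: the classes in `Φ_n` not represented by `M`
(used for `M` of rank at least `n`). -/
def exceptionalSet (n : ℕ) (M : IntegralLattice) : Set LatticeClass :=
  {c | c ∈ Phi n ∧ ¬ RepresentsClass M c}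

/-- `E` is an `n`-exceptional set: it is the `n`-exceptional set of some integral lattice of
rank at least `n`. -/
def IsExceptionalSet (n : ℕ) (E : Set LatticeClass) : Prop :=
  ∃ M : IntegralLattice, n ≤ M.1.rank ∧ exceptionalSet n M = E

/-- `M` is `S`-universal: it represents all classes in `S`. -/
def IsUniversal (S : Set LatticeClass) (M : IntegralLattice) : Prop :=
  ∀ c ∈ S, RepresentsClass M c

/-- `X` is an `S`-universality criterion set: a finite subset of `S` such that every
`X`-universal integral lattice is `S`-universal. -/
def IsUniversalityCriterionSet (S X : Set LatticeClass) : Prop :=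
  X ⊆ S ∧ X.Finite ∧ ∀ M : IntegralLattice, IsUniversal X M → IsUniversal S M

/-! ### Legendre's theorem on ternary quadratic forms -/

/-! The equivalence is formal once a finiteness statement is known
(`exists_finite_universality_criterion`): every set S of classes of rank n has a finite subset X
such that representing X forces representing S. If a lattice misses only cls N, a criterion set
avoiding cls N would be represented by it, which is absurd. Conversely, apply finiteness to Φ_n
minus cls N. The resulting X avoids cls N, so it is not a criterion set for Φ_n; some M therefore
represents X, hence everything except cls N, and misses cls N. Its rank is at least n because it
represents a rescaled copy of N.

Finiteness is a compactness argument. If it fails, each finite X ⊆ S has a lattice L_X representing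
X but not S. An ultralimit of pulled-back forms is a positive semidefinite integral form, possibly
of infinite rank, which represents all of S. By `exists_fg_gramRealized` one finitely generated
submodule already realizes all the Gram matrices; on it the limit agrees with the form of a single
L_X, a contradiction.

For `exists_fg_gramRealized`, suppose first that some finite set has no vector of positive norm
orthogonal to it; then the form is finitely generated modulo its radical. Otherwise there is an
infinite orthogonal sequence of vectors of positive norm, and Legendre's theorem together with
Dirichlet's theorem on primes turns it into arbitrarily long orthogonal systems of equal norm D.
Reduction theory writes every Gram matrix, after a change of basis, as a nonnegative combination of
squares of linear forms l from a fixed finite set. A Dickson-type argument then finds, in any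
infinite sequence of such matrices, an earlier and a later one differing by a sum of 2D·k_l·l², each
k_l being zero or large. Quaternion multiplication and the four squares theorem produce, inside the
orthogonal system and orthogonally to the earlier tuple, vectors of norm 2D·k_l; adding them to the
earlier tuple realizes the later matrix. So no infinite sequence of new Gram matrices exists. -/

theorem exists_box_side {m : ℕ} (hm : 0 < m) :
    ∃ A : ℕ, m ≤ A ^ 2 ∧ (¬ IsSquare m → m < A ^ 2) ∧ ∀ x : ℤ, |x| < A → x ^ 2 < m := by
  have h1 := Nat.sqrt_le' (m - 1)
  have h2 := Nat.lt_succ_sqrt' (m - 1)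
  simp only [Nat.succ_eq_add_one] at h2
  refine ⟨(m - 1).sqrt + 1, by omega, fun h => ?_, fun x hx => ?_⟩
  · refine lt_of_le_of_ne (by omega) fun h' => h ⟨_, h'.trans (sq _)⟩
  · have h3 : |x| ≤ ((m - 1).sqrt : ℤ) := by push_cast at hx; omega
    have h4 : |x| ^ 2 ≤ ((m - 1).sqrt : ℤ) ^ 2 := pow_le_pow_left₀ (abs_nonneg x) h3 2
    rw [sq_abs] at h4
    have h5 : (((m - 1).sqrt : ℤ)) ^ 2 ≤ ((m - 1 : ℕ) : ℤ) := by exact_mod_cast h1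
    have h6 : ((m - 1 : ℕ) : ℤ) < m := by omega
    omega

-- Pigeonhole in a box with sides about √(bc), √(ac), √(ab): two points agree in three linear
-- congruences which make F = ax² + by² − cz² divisible by abc at their difference. The size of the
-- box leaves only F = 0 and F = abc.
set_option maxHeartbeats 400000 in
theorem legendre_ternary {a b c : ℕ} (ha : 0 < a) (hb : 0 < b) (hc : 0 < c)
    (hab : a.Coprime b) (hac : a.Coprime c) (hbc : b.Coprime c) (hsq : ¬ IsSquare (b * c))
    {r s t : ℤ} (hr : (a : ℤ) ∣ r ^ 2 - b * c) (hs : (b : ℤ) ∣ s ^ 2 - a * c)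
    (ht : (c : ℤ) ∣ t ^ 2 + a * b) :
    ∃ x y z : ℤ, z ≠ 0 ∧ a * x ^ 2 + b * y ^ 2 = c * z ^ 2 := by
  obtain ⟨A, hA, hA', hA''⟩ := exists_box_side (Nat.mul_pos hb hc)
  obtain ⟨B, hB, -, hB''⟩ := exists_box_side (Nat.mul_pos ha hc)
  obtain ⟨C, hC, -, hC''⟩ := exists_box_side (Nat.mul_pos ha hb)
  -- The strict inequality needed for the pigeonhole comes only from bc not being a square.
  have hbig : a * b * c < A * B * C := by
    have h1 : (a * b * c) ^ 2 < (A * B * C) ^ 2 := by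
      calc (a * b * c) ^ 2 = (b * c) * ((a * c) * (a * b)) := by ring
        _ < A ^ 2 * ((a * c) * (a * b)) := Nat.mul_lt_mul_of_pos_right (hA' hsq) (by positivity)
        _ ≤ A ^ 2 * (B ^ 2 * C ^ 2) := by gcongr
        _ = (A * B * C) ^ 2 := by ring
    exact lt_of_pow_lt_pow_left₀ 2 (by positivity) h1
  have : NeZero a := ⟨ha.ne'⟩
  have : NeZero b := ⟨hb.ne'⟩
  have : NeZero c := ⟨hc.ne'⟩
  let f : Fin A × Fin B × Fin C → ZMod a × ZMod b × ZMod c := fun p =>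
    (((b * (p.2.1 : ℕ) - r * (p.2.2 : ℕ) : ℤ) : ZMod a),
      ((a * (p.1 : ℕ) - s * (p.2.2 : ℕ) : ℤ) : ZMod b),
      ((a * (p.1 : ℕ) - t * (p.2.1 : ℕ) : ℤ) : ZMod c))
  have hcard : Fintype.card (ZMod a × ZMod b × ZMod c) < Fintype.card (Fin A × Fin B × Fin C) := by
    simp only [Fintype.card_prod, ZMod.card, Fintype.card_fin]
    nlinarith
  obtain ⟨p, q, hpq, hfpq⟩ := Fintype.exists_ne_map_eq_of_card_lt f hcard
  obtain ⟨x, hx⟩ : ∃ x : ℤ, x = (p.1 : ℕ) - (q.1 : ℕ) := ⟨_, rfl⟩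
  obtain ⟨y, hy⟩ : ∃ y : ℤ, y = (p.2.1 : ℕ) - (q.2.1 : ℕ) := ⟨_, rfl⟩
  obtain ⟨z, hz⟩ : ∃ z : ℤ, z = (p.2.2 : ℕ) - (q.2.2 : ℕ) := ⟨_, rfl⟩
  have hx2 : x ^ 2 < b * c := by
    have := hA'' x (by rw [hx, abs_lt]; constructor <;> omega)
    exact_mod_cast this
  have hy2 : y ^ 2 < a * c := by
    have := hB'' y (by rw [hy, abs_lt]; constructor <;> omega)
    exact_mod_cast this
  have hz2 : z ^ 2 < a * b := by
    have := hC'' z (by rw [hz, abs_lt]; constructor <;> omega)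
    exact_mod_cast this
  have hne : ¬ (x = 0 ∧ y = 0 ∧ z = 0) := by
    rintro ⟨h1, h2, h3⟩
    apply hpq
    refine Prod.ext (Fin.ext (by omega)) (Prod.ext (Fin.ext (by omega)) (Fin.ext (by omega)))
  simp only [f, Prod.mk.injEq] at hfpq
  obtain ⟨h1, h2, h3⟩ := hfpq
  rw [ZMod.intCast_eq_intCast_iff_dvd_sub] at h1 h2 h3
  have d1 : (a : ℤ) ∣ b * y - r * z := by
    obtain ⟨k, hk⟩ := h1
    exact ⟨-k, by rw [hy, hz]; linear_combination -hk⟩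
  have d2 : (b : ℤ) ∣ a * x - s * z := by
    obtain ⟨k, hk⟩ := h2
    exact ⟨-k, by rw [hx, hz]; linear_combination -hk⟩
  have d3 : (c : ℤ) ∣ a * x - t * y := by
    obtain ⟨k, hk⟩ := h3
    exact ⟨-k, by rw [hx, hy]; linear_combination -hk⟩
  obtain ⟨F, hF⟩ : ∃ F : ℤ, F = a * x ^ 2 + b * y ^ 2 - c * z ^ 2 := ⟨_, rfl⟩
  have e1 : (a : ℤ) ∣ F := by
    have hcop : IsCoprime (a : ℤ) b := Nat.isCoprime_iff_coprime.2 hab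
    refine hcop.dvd_of_dvd_mul_left (?_ : (a : ℤ) ∣ b * F)
    have : (b : ℤ) * F = a * (b * x ^ 2) + (b * y - r * z) * (b * y + r * z)
        + (r ^ 2 - b * c) * z ^ 2 := by rw [hF]; ring
    rw [this]
    exact dvd_add (dvd_add (dvd_mul_right _ _) (d1.mul_right _)) (hr.mul_right _)
  have e2 : (b : ℤ) ∣ F := by
    have hcop : IsCoprime (b : ℤ) a := Nat.isCoprime_iff_coprime.2 hab.symm
    refine hcop.dvd_of_dvd_mul_left (?_ : (b : ℤ) ∣ a * F)
    have : (a : ℤ) * F = b * (a * y ^ 2) + (a * x - s * z) * (a * x + s * z)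
        + (s ^ 2 - a * c) * z ^ 2 := by rw [hF]; ring
    rw [this]
    exact dvd_add (dvd_add (dvd_mul_right _ _) (d2.mul_right _)) (hs.mul_right _)
  have e3 : (c : ℤ) ∣ F := by
    have hcop : IsCoprime (c : ℤ) a := Nat.isCoprime_iff_coprime.2 hac.symm
    refine hcop.dvd_of_dvd_mul_left (?_ : (c : ℤ) ∣ a * F)
    have : (a : ℤ) * F = (a * x - t * y) * (a * x + t * y) + (t ^ 2 + a * b) * y ^ 2
        - c * (a * z ^ 2) := by rw [hF]; ring
    rw [this]
    exact dvd_sub (dvd_add (d3.mul_right _) (ht.mul_right _)) (dvd_mul_right _ _)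
  have e : ((a : ℤ) * b * c) ∣ F := by
    refine IsCoprime.mul_dvd (Nat.isCoprime_iff_coprime.2 ?_) (IsCoprime.mul_dvd
      (Nat.isCoprime_iff_coprime.2 hab) e1 e2) e3 |> fun h => by simpa using h
    exact Nat.Coprime.mul_left hac hbc
  have ha' : (0 : ℤ) < a := by exact_mod_cast ha
  have hb' : (0 : ℤ) < b := by exact_mod_cast hb
  have hc' : (0 : ℤ) < c := by exact_mod_cast hc
  have u1 : F < 2 * (a * b * c) := by
    have k1 := mul_lt_mul_of_pos_left hx2 ha'
    have k2 := mul_lt_mul_of_pos_left hy2 hb'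
    have k3 : 0 ≤ (c : ℤ) * z ^ 2 := by positivity
    rw [hF]; linarith
  have u2 : -(a * b * c) < F := by
    have k1 := mul_lt_mul_of_pos_left hz2 hc'
    have k2 : 0 ≤ (a : ℤ) * x ^ 2 := by positivity
    have k3 : 0 ≤ (b : ℤ) * y ^ 2 := by positivity
    rw [hF]; linarith
  have habc : (0 : ℤ) < a * b * c := by positivity
  obtain ⟨k, hk⟩ := e
  rw [hk] at u1 u2
  have hk1 : k < 2 := by nlinarith
  have hk2 : -1 < k := by nlinarith
  have hk3 : k = 0 ∨ k = 1 := by omega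
  rcases hk3 with rfl | rfl
  · refine ⟨x, y, z, fun h0 => hne ?_, by rw [hk] at hF; linarith⟩
    rw [h0] at hF
    have k2 : 0 ≤ (a : ℤ) * x ^ 2 := by positivity
    have k3 : 0 ≤ (b : ℤ) * y ^ 2 := by positivity
    have k4 : (a : ℤ) * x ^ 2 = 0 := by rw [hk] at hF; linarith
    have k5 : (b : ℤ) * y ^ 2 = 0 := by rw [hk] at hF; linarith
    refine ⟨?_, ?_, h0⟩
    · simpa [ha.ne'] using k4
    · simpa [hb.ne'] using k5
  -- Here F = abc, that is ax² + by² = c(z² + ab). Multiplying by z² + ab, the left side is again of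
  -- the form a·□ + b·□ by composition.
  · refine ⟨x * z + b * y, y * z - a * x, z ^ 2 + a * b,
      (add_pos_of_nonneg_of_pos (sq_nonneg z) (mul_pos ha' hb')).ne', ?_⟩
    have : (a : ℤ) * x ^ 2 + b * y ^ 2 = c * (z ^ 2 + a * b) := by
      rw [hk] at hF; linarith
    linear_combination (z ^ 2 + (a : ℤ) * b) * this

/-! ### Representation of primes and of `1` by diagonal forms -/

theorem exists_sq_add_of_isSquare {q : ℕ} {u : ℤ} (h : IsSquare (u : ZMod q)) :
    ∃ t : ℤ, (q : ℤ) ∣ t ^ 2 - u := by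
  obtain ⟨v, hv⟩ := h
  obtain ⟨t, rfl⟩ := ZMod.intCast_surjective v
  refine ⟨t, ?_⟩
  rw [← ZMod.intCast_eq_intCast_iff_dvd_sub]
  push_cast
  rw [hv]; ring

-- Dirichlet gives a prime q with q ≡ b mod a, q ≡ a mod b, and q ≡ 1 mod 4 and mod N. Then bq and
-- aq are squares mod a and mod b, and reciprocity turns (−ab/q) into (b/a)(a/b), which is 1 because
-- a ≡ 1 mod 4. So Legendre's theorem applies.
open scoped NumberTheorySymbols in
theorem exists_prime_represented_by_binary {a b N : ℕ} (hab : a.Coprime b) (ha : a % 4 = 1)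
    (hb : Odd b) (hN : 0 < N) (hNa : N.Coprime a) (hNb : N.Coprime b) (hN2 : Odd N) (m : ℕ) :
    ∃ q : ℕ, m < q ∧ q.Prime ∧ q % 4 = 1 ∧ (q : ZMod N) = 1 ∧
      ∃ x y z : ℤ, z ≠ 0 ∧ a * x ^ 2 + b * y ^ 2 = q * z ^ 2 := by
  have hao : Odd a := by rw [Nat.odd_iff]; omega
  have ha0 : 0 < a := by omega
  have hb0 : 0 < b := hb.pos
  have c4a : Nat.Coprime 4 a := by
    rw [show (4 : ℕ) = 2 ^ 2 by norm_num]
    exact Nat.Coprime.pow_left 2 (Nat.coprime_two_left.2 hao)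
  have c4b : Nat.Coprime 4 b := by
    rw [show (4 : ℕ) = 2 ^ 2 by norm_num]
    exact Nat.Coprime.pow_left 2 (Nat.coprime_two_left.2 hb)
  have c4N : Nat.Coprime 4 N := by
    rw [show (4 : ℕ) = 2 ^ 2 by norm_num]
    exact Nat.Coprime.pow_left 2 (Nat.coprime_two_left.2 hN2)
  obtain ⟨k1, hk1, hk1'⟩ := Nat.chineseRemainder hab b a
  obtain ⟨k2, hk2, hk2'⟩ := Nat.chineseRemainder c4N 1 1
  have hcop : (a * b).Coprime (4 * N) := by
    apply Nat.Coprime.mul_left <;> apply Nat.Coprime.mul_right <;>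
      first | assumption | (apply Nat.Coprime.symm; assumption)
  obtain ⟨k, hk, hk'⟩ := Nat.chineseRemainder hcop k1 k2
  have ka : k ≡ b [MOD a] := (hk.of_dvd (dvd_mul_right _ _)).trans hk1
  have kb : k ≡ a [MOD b] := (hk.of_dvd (dvd_mul_left _ _)).trans hk1'
  have k4 : k ≡ 1 [MOD 4] := (hk'.of_dvd (dvd_mul_right _ _)).trans hk2
  have kN : k ≡ 1 [MOD N] := (hk'.of_dvd (dvd_mul_left _ _)).trans hk2'
  have cop1 : ∀ {m u : ℕ}, k ≡ u [MOD m] → u.Coprime m → k.Coprime m := fun h h' => by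
    rw [Nat.Coprime, h.gcd_eq]; exact h'
  have hkcop : k.Coprime (a * b * (4 * N)) := by
    refine Nat.Coprime.mul_right (Nat.Coprime.mul_right (cop1 ka hab.symm) (cop1 kb hab))
      (Nat.Coprime.mul_right (cop1 k4 (by simp)) (cop1 kN (by simp)))
  have : NeZero (a * b * (4 * N)) := ⟨by positivity⟩
  -- The bound m + a + b keeps q from dividing a or b; this gives coprimality and that bq is not a
  -- square.
  obtain ⟨q, hqm, hqp, hq⟩ := Nat.forall_exists_prime_gt_and_eq_mod
    ((ZMod.isUnit_iff_coprime k (a * b * (4 * N))).2 hkcop) (m + a + b)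
  rw [ZMod.natCast_eq_natCast_iff] at hq
  have qa : q ≡ b [MOD a] :=
    (hq.of_dvd ((dvd_mul_right a b).trans (dvd_mul_right _ _))).trans ka
  have qb : q ≡ a [MOD b] :=
    (hq.of_dvd ((dvd_mul_left b a).trans (dvd_mul_right _ _))).trans kb
  have q4 : q ≡ 1 [MOD 4] :=
    (hq.of_dvd ((dvd_mul_right 4 N).trans (dvd_mul_left _ _))).trans k4
  have qN : q ≡ 1 [MOD N] :=
    (hq.of_dvd ((dvd_mul_left N 4).trans (dvd_mul_left _ _))).trans kN
  have q4' : q % 4 = 1 := q4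
  have hqo : Odd q := by rw [Nat.odd_iff]; omega
  have hqa : a.Coprime q :=
    ((Nat.Prime.coprime_iff_not_dvd hqp).2 fun h => by have := Nat.le_of_dvd ha0 h; omega).symm
  have hqb : b.Coprime q :=
    ((Nat.Prime.coprime_iff_not_dvd hqp).2 fun h => by have := Nat.le_of_dvd hb0 h; omega).symm
  refine ⟨q, by omega, hqp, q4', by simpa using (ZMod.natCast_eq_natCast_iff q 1 N).2 qN, ?_⟩
  have : Fact q.Prime := ⟨hqp⟩
  have hsq : ¬ IsSquare (b * q) := by
    rintro ⟨w, hw⟩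
    have h1 : q ∣ w * w := hw ▸ dvd_mul_left q b
    have h2 : q ∣ w := (or_self_iff.1 ((Nat.Prime.dvd_mul hqp).1 h1))
    obtain ⟨w', rfl⟩ := h2
    have h3 : b = q * (w' * w') := by
      apply Nat.eq_of_mul_eq_mul_right hqp.pos; rw [hw]; ring
    have := Nat.le_of_dvd hb0 (h3 ▸ dvd_mul_right q (w' * w') : q ∣ b)
    omega
  have J : J(-(a * b : ℤ) | q) = 1 := by
    rw [jacobiSym.neg _ hqo, ZMod.χ₄_nat_one_mod_four q4', one_mul, jacobiSym.mul_left,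
      jacobiSym.quadratic_reciprocity_one_mod_four' hao q4',
      jacobiSym.quadratic_reciprocity_one_mod_four' hb q4',
      jacobiSym.mod_left' (b := a) (a₂ := b) (by exact_mod_cast (Int.natCast_modEq_iff.2 qa)),
      jacobiSym.mod_left' (b := b) (a₂ := a) (by exact_mod_cast (Int.natCast_modEq_iff.2 qb)),
      jacobiSym.quadratic_reciprocity_one_mod_four ha hb, ← sq]
    exact jacobiSym.sq_one (by rw [Int.gcd_natCast_natCast]; exact hab.symm)
  obtain ⟨t, ht⟩ := exists_sq_add_of_isSquare (ZMod.isSquare_of_jacobiSym_eq_one J)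
  refine legendre_ternary ha0 hb0 hqp.pos hab hqa hqb hsq (r := b) (s := a) (t := t) ?_ ?_ ?_
  · obtain ⟨k, hk⟩ : (a : ℤ) ∣ b - q := (Int.natCast_modEq_iff.2 qa).dvd
    exact ⟨b * k, by linear_combination (b : ℤ) * hk⟩
  · obtain ⟨k, hk⟩ : (b : ℤ) ∣ a - q := (Int.natCast_modEq_iff.2 qb).dvd
    exact ⟨a * k, by linear_combination (a : ℤ) * hk⟩
  · simpa using ht

-- Legendre's theorem with c = 1: q' ≡ 1 is a square mod q, and reciprocity then makes q a square
-- mod q'.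
open scoped NumberTheorySymbols in
theorem exists_sq_of_prime_pair {q q' : ℕ} (hq : q.Prime) (hq' : q'.Prime) (hqq : q < q')
    (h4 : q % 4 = 1) (h4' : q' % 4 = 1) (h : (q' : ZMod q) = 1) :
    ∃ x y z : ℤ, z ≠ 0 ∧ q * x ^ 2 + q' * y ^ 2 = z ^ 2 := by
  have : Fact q.Prime := ⟨hq⟩
  have : Fact q'.Prime := ⟨hq'⟩
  have hqo' : Odd q' := by rw [Nat.odd_iff]; omega
  have hmod : q' ≡ 1 [MOD q] := (ZMod.natCast_eq_natCast_iff _ _ _).1 (by simpa using h)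
  have J : J((q : ℤ) | q') = 1 := by
    rw [jacobiSym.quadratic_reciprocity_one_mod_four h4 hqo',
      jacobiSym.mod_left' (b := q) (a₂ := ((1 : ℕ) : ℤ))
        (by exact_mod_cast (Int.natCast_modEq_iff.2 hmod))]
    simp
  obtain ⟨t, ht⟩ := exists_sq_add_of_isSquare (ZMod.isSquare_of_jacobiSym_eq_one J)
  have hd : (q : ℤ) ∣ 1 - q' := by simpa using (Int.natCast_modEq_iff.2 hmod).dvd
  have := legendre_ternary (a := q) (b := q') (c := 1) hq.pos hq'.pos one_pos
    ((Nat.coprime_primes hq hq').2 hqq.ne) (by simp) (by simp)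
    (by rw [mul_one]; exact hq'.prime.irreducible.not_isSquare) (r := 1) (s := t) (t := 0)
    (by simpa using hd) (by simpa using ht) (by simp)
  simpa using this

/-- Two pairs of coprime odd numbers, each with an entry `≡ 1 (mod 4)`, give a quaternary
diagonal form representing a square. -/
theorem exists_sq_of_coprime_pairs {a b c d : ℕ} (hab : a.Coprime b) (ha : a % 4 = 1) (hb : Odd b)
    (hcd : c.Coprime d) (hc : c % 4 = 1) (hd : Odd d) :
    ∃ (q q' : ℕ) (x y z x' y' z' u v w : ℤ), z ≠ 0 ∧ z' ≠ 0 ∧ w ≠ 0 ∧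
      a * x ^ 2 + b * y ^ 2 = q * z ^ 2 ∧ c * x' ^ 2 + d * y' ^ 2 = q' * z' ^ 2 ∧
      q * u ^ 2 + q' * v ^ 2 = w ^ 2 := by
  have hc0 : 0 < c := by omega
  -- Taking q > c + d makes it coprime to c and d, so it can serve as the modulus N for the second
  -- prime, which forces q' ≡ 1 mod q.
  obtain ⟨q, hqm, hqp, hq4, -, x, y, z, hz, h1⟩ := exists_prime_represented_by_binary hab ha hb
    one_pos (by simp) (by simp) (by simp) (c + d)
  obtain ⟨q', hqm', hqp', hq4', hqq, x', y', z', hz', h2⟩ :=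
    exists_prime_represented_by_binary hcd hc hd (N := q) hqp.pos
    ((Nat.Prime.coprime_iff_not_dvd hqp).2 fun h => by have := Nat.le_of_dvd hc0 h; omega)
    ((Nat.Prime.coprime_iff_not_dvd hqp).2 fun h => by have := Nat.le_of_dvd hd.pos h; omega)
    (by rw [Nat.odd_iff]; omega) q
  obtain ⟨u, v, w, hw, h3⟩ := exists_sq_of_prime_pair hqp hqp' hqm' hq4 hq4' hqq
  exact ⟨q, q', x, y, z, x', y', z', u, v, w, hz, hz', hw, h1, h2, h3⟩

/-! ### Reduction theory: positive definite forms as bounded sums of squares of linear forms -/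

/-- The value at `x` of the integral linear form with coefficients `l`. -/
def linForm {n : ℕ} (l x : Fin n → ℤ) : ℤ := ∑ i, l i * x i

theorem linForm_add_left {n : ℕ} (l l' x : Fin n → ℤ) :
    linForm (l + l') x = linForm l x + linForm l' x := by
  simp [linForm, add_mul, Finset.sum_add_distrib]

theorem linForm_sub_left {n : ℕ} (l l' x : Fin n → ℤ) :
    linForm (l - l') x = linForm l x - linForm l' x := by
  simp [linForm, sub_mul, Finset.sum_sub_distrib]

/-- The convex cone generated by the squares of integral linear forms in `n` variables with
coefficients bounded by `T`. -/
noncomputable def formCone (n : ℕ) (T : ℤ) : Submodule NNReal ((Fin n → ℤ) → ℝ) :=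
  Submodule.span NNReal
    {f | ∃ l : Fin n → ℤ, (∀ i, |l i| ≤ T) ∧ f = fun x => ((linForm l x : ℤ) : ℝ) ^ 2}

theorem formCone_mono (n : ℕ) {T T' : ℤ} (h : T ≤ T') : formCone n T ≤ formCone n T' :=
  Submodule.span_mono fun _ ⟨l, hl, hf⟩ => ⟨l, fun i => (hl i).trans h, hf⟩

theorem formCone_const_mul {n : ℕ} {T : ℤ} {f : (Fin n → ℤ) → ℝ} (hf : f ∈ formCone n T)
    {c : ℝ} (hc : 0 ≤ c) : (fun x => c * f x) ∈ formCone n T := by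
  exact (formCone n T).smul_mem ⟨c, hc⟩ hf

theorem formCone_sq {n : ℕ} {T : ℤ} {l : Fin n → ℤ} (hl : ∀ i, |l i| ≤ T) {c : ℝ} (hc : 0 ≤ c) :
    (fun x => c * ((linForm l x : ℤ) : ℝ) ^ 2) ∈ formCone n T :=
  formCone_const_mul (Submodule.subset_span ⟨l, hl, rfl⟩) hc

theorem formCone_add {n : ℕ} {T : ℤ} {f g : (Fin n → ℤ) → ℝ} (hf : f ∈ formCone n T)
    (hg : g ∈ formCone n T) : (fun x => f x + g x) ∈ formCone n T :=
  (formCone n T).add_mem hf hg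

theorem formCone_sum {n : ℕ} {T : ℤ} {ι : Type*} [Fintype ι] {f : ι → (Fin n → ℤ) → ℝ}
    (hf : ∀ i, f i ∈ formCone n T) : (fun x => ∑ i, f i x) ∈ formCone n T := by
  convert (formCone n T).sum_mem (t := Finset.univ) (fun i _ => hf i) using 1
  ext x; simp

theorem formCone_tail {n : ℕ} {T : ℤ} (hT : 0 ≤ T) {f : (Fin n → ℤ) → ℝ} (hf : f ∈ formCone n T) :
    (fun x : Fin (n + 1) → ℤ => f (fun i => x i.succ)) ∈ formCone (n + 1) T := by
  induction hf using Submodule.span_induction with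
  | mem f hf =>
    obtain ⟨l, hl, rfl⟩ := hf
    refine Submodule.subset_span ⟨Fin.cons 0 l, fun i => ?_, ?_⟩
    · refine Fin.cases ?_ (fun i => ?_) i
      · simpa using hT
      · simpa using hl i
    · ext x; simp [linForm, Fin.sum_univ_succ]
  | zero => exact (formCone (n + 1) T).zero_mem
  | add f g _ _ hf hg => exact formCone_add hf hg
  | smul c f _ hf => exact formCone_const_mul hf c.2

theorem formCone_sum_sq {n : ℕ} {T : ℤ} (hT : 1 ≤ T) {c : ℝ} (hc : 0 ≤ c) :
    (fun x : Fin n → ℤ => c * ∑ i, ((x i : ℤ) : ℝ) ^ 2) ∈ formCone n T := by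
  have : ∀ i : Fin n, (fun x : Fin n → ℤ => ((x i : ℤ) : ℝ) ^ 2) ∈ formCone n T := fun i => by
    refine Submodule.subset_span ⟨Pi.single i 1, fun j => ?_, ?_⟩
    · by_cases h : j = i
      · subst h; simpa using hT
      · simp [h]; omega
    · ext x; simp [linForm, Pi.single_apply]
  exact formCone_const_mul (formCone_sum this) hc

/-- Diagonally dominant forms in given bounded linear forms lie in the cone. -/
theorem formCone_of_dominant {n : ℕ} {T : ℤ} {ι : Type*} [Fintype ι] {l : ι → Fin n → ℤ}
    (hl : ∀ i a, |l i a| ≤ T) {S : ι → ι → ℝ} {d : ι → ℝ} {τ : ℝ} (hS : ∀ i j, |S i j| ≤ τ)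
    (hd : ∀ i, Fintype.card ι * τ ≤ d i) :
    (fun x => ∑ i, ∑ j, S i j * (linForm (l i) x * linForm (l j) x)
      + ∑ i, d i * ((linForm (l i) x : ℤ) : ℝ) ^ 2) ∈ formCone n (2 * T) := by
  -- Each product l_i l_j is traded for squares of l_i ± l_j with nonnegative coefficients, at the
  -- cost of τ/2·(l_i² + l_j²). The total cost is card·τ per form, which the diagonal absorbs.
  have h1 : ∀ i j, (fun x => (τ + S i j) / 4 * ((linForm (l i + l j) x : ℤ) : ℝ) ^ 2
      + (τ - S i j) / 4 * ((linForm (l i - l j) x : ℤ) : ℝ) ^ 2) ∈ formCone n (2 * T) := by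
    intro i j
    have := abs_le.1 (hS i j)
    refine formCone_add (formCone_sq (fun a => ?_) (by linarith))
      (formCone_sq (fun a => ?_) (by linarith))
    · have := abs_add_le (l i a) (l j a)
      have := hl i a; have := hl j a
      simp only [Pi.add_apply]; omega
    · have := abs_sub (l i a) (l j a)
      have := hl i a; have := hl j a
      simp only [Pi.sub_apply]; omega
  have h2 : ∀ i, (fun x => (d i - Fintype.card ι * τ) * ((linForm (l i) x : ℤ) : ℝ) ^ 2)
      ∈ formCone n (2 * T) := fun i => by
    refine formCone_sq (fun a => ?_) (by linarith [hd i])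
    have := hl i a; have := abs_nonneg (l i a); omega
  convert formCone_add (formCone_sum fun i => formCone_sum fun j => h1 i j)
    (formCone_sum h2) using 1
  ext x
  have h3 : ∀ i j, (τ + S i j) / 4 * ((linForm (l i + l j) x : ℤ) : ℝ) ^ 2
      + (τ - S i j) / 4 * ((linForm (l i - l j) x : ℤ) : ℝ) ^ 2
      = S i j * (linForm (l i) x * linForm (l j) x)
        + (τ / 2 * ((linForm (l i) x : ℤ) : ℝ) ^ 2 + τ / 2 * ((linForm (l j) x : ℤ) : ℝ) ^ 2) := by
    intro i j
    rw [linForm_add_left, linForm_sub_left]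
    push_cast; ring
  simp only [h3, Finset.sum_add_distrib, Finset.sum_const, Finset.card_univ, nsmul_eq_mul, sub_mul,
    Finset.sum_sub_distrib, ← Finset.mul_sum, mul_assoc]
  ring

/-- Round each u_i to a fraction w_i with denominator q. In the forms y_0 = x_0 + ∑ w_i x_i and y_i
= x_i the expression is diagonal, with entries 1 − 1/q and η − 1/q, up to an error matrix with
entries at most 2/q; the lower bound on qη makes the diagonal dominate. The forms q·y_i are
integral. -/
theorem formCone_shear {N : ℕ} {η : ℝ} (hη1 : η ≤ 1) {q : ℕ} (hq : 0 < q)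
    (hqη : 3 * (N + 1) ≤ q * η) {u : Fin N → ℝ} (hu : ∀ i, |u i| ≤ 1 / 2) :
    (fun x : Fin (N + 1) → ℤ => ((x 0 : ℝ) + ∑ i, u i * (x i.succ : ℝ)) ^ 2
      + η * ∑ i : Fin N, (x i.succ : ℝ) ^ 2 - 1 / q * ∑ i, (x i : ℝ) ^ 2)
      ∈ formCone (N + 1) (2 * q) := by
  have hq0 : (0 : ℝ) < q := by exact_mod_cast hq
  have hq1 : (1 : ℝ) ≤ q := by exact_mod_cast hq
  let r : Fin N → ℤ := fun i => round (q * u i)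
  let w : Fin N → ℝ := fun i => r i / q
  let δ : Fin N → ℝ := fun i => u i - w i
  have hr : ∀ i, |r i| ≤ q := fun i => by
    have h1 : |(q * u i) - r i| ≤ 1 / 2 := abs_sub_round _
    have h2 : |q * u i| ≤ q * (1 / 2) := by
      rw [abs_mul, abs_of_pos hq0]; exact mul_le_mul_of_nonneg_left (hu i) hq0.le
    have h3 : (|r i| : ℝ) ≤ q := by
      have := abs_sub_abs_le_abs_sub ((r i : ℝ)) (q * u i)
      rw [abs_sub_comm] at this
      linarith
    exact_mod_cast h3
  have hδ : ∀ i, |δ i| ≤ 1 / (2 * q) := fun i => by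
    have h1 : |(q * u i) - r i| ≤ 1 / 2 := abs_sub_round _
    have h2 : δ i = (q * u i - r i) / q := by simp only [δ, w]; field_simp
    rw [h2, abs_div, abs_of_pos hq0, div_le_div_iff₀ hq0 (by positivity)]
    nlinarith
  have hw : ∀ i, |w i| ≤ 1 := fun i => by
    simp only [w, abs_div, abs_of_pos hq0]
    rw [div_le_one hq0]; exact_mod_cast hr i
  -- In the coordinates y, the vectors α, β, e give x_0 + ∑ u_i x_i, x_0 and y_0 respectively; S is
  -- what remains after the diagonal d is removed.
  let α : Fin (N + 1) → ℝ := Fin.cons 1 δ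
  let β : Fin (N + 1) → ℝ := Fin.cons 1 (fun i => - w i)
  let e : Fin (N + 1) → ℝ := Fin.cons 1 (fun _ => 0)
  let S : Fin (N + 1) → Fin (N + 1) → ℝ := fun i j =>
    α i * α j - e i * e j - 1 / q * (β i * β j - e i * e j)
  let d : Fin (N + 1) → ℝ := Fin.cons (1 - 1 / q) (fun _ => η - 1 / q)
  let l : Fin (N + 1) → Fin (N + 1) → ℤ := Fin.cons (Fin.cons q r) (fun i => Pi.single i.succ q)
  have hl : ∀ i a, |l i a| ≤ q := by
    intro i a
    refine Fin.cases ?_ (fun i => ?_) i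
    · refine Fin.cases ?_ (fun a => ?_) a
      · simp [l]
      · simpa [l] using hr a
    · simp only [l, Fin.cons_succ, Pi.single_apply]
      split_ifs <;> simp
  have hS : ∀ i j, |S i j| ≤ 2 / q := by
    have hq' : (0 : ℝ) < 1 / q := by positivity
    have hq'' : (1 : ℝ) / q ≤ 1 := by rw [div_le_one hq0]; exact hq1
    have e2 : (2 : ℝ) / q = 2 * (1 / q) := by ring
    have e3 : (1 : ℝ) / (2 * q) = (1 / q) / 2 := by field_simp
    have b1 : ∀ i, |δ i + 1 / q * w i| ≤ 2 / q := fun i => by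
      have h1 := hδ i; have h2 := hw i
      have h3 := abs_add_le (δ i) (1 / q * w i)
      rw [abs_mul, abs_of_pos hq'] at h3
      rw [e2]; rw [e3] at h1
      nlinarith
    intro i j
    refine Fin.cases ?_ (fun i => ?_) i
    · refine Fin.cases ?_ (fun j => ?_) j
      · simp only [S, α, β, e, Fin.cons_zero]
        norm_num
        positivity
      · convert b1 j using 2
        simp [S, α, β, e]
    · refine Fin.cases ?_ (fun j => ?_) j
      · convert b1 i using 2
        simp [S, α, β, e]
      · have h0 : S i.succ j.succ = δ i * δ j - 1 / q * (w i * w j) := by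
          simp [S, α, β, e]
        rw [h0, e2]
        have h1 := abs_sub (δ i * δ j) (1 / q * (w i * w j))
        rw [abs_mul, abs_mul, abs_mul (w i), abs_of_pos hq'] at h1
        have k1 := hδ i; have k2 := hδ j; have k3 := hw i; have k4 := hw j
        rw [e3] at k1 k2
        have m1 : |δ i| * |δ j| ≤ (1 / q) / 2 * 1 :=
          mul_le_mul k1 (by linarith) (abs_nonneg _) (by linarith)
        have m2 : |w i| * |w j| ≤ 1 * 1 := mul_le_mul k3 k4 (abs_nonneg _) (by linarith)
        have m3 := mul_le_mul_of_nonneg_left m2 hq'.le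
        linarith
  have hη' : (N + 1 : ℝ) * (2 / q) ≤ η - 1 / q := by
    have h1 : 3 * (N + 1 : ℝ) / q ≤ η := by rw [div_le_iff₀ hq0]; linarith
    have h2 : (N + 1 : ℝ) * (2 / q) + 1 / q ≤ 3 * (N + 1 : ℝ) / q := by
      rw [← sub_nonneg]
      have : 3 * (N + 1 : ℝ) / q - ((N + 1 : ℝ) * (2 / q) + 1 / q) = N / q := by field_simp; ring
      rw [this]; positivity
    linarith
  have hd : ∀ i, Fintype.card (Fin (N + 1)) * (2 / q : ℝ) ≤ d i := by
    intro i
    rw [Fintype.card_fin]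
    push_cast
    refine Fin.cases ?_ (fun i => ?_) i
    · simp only [d, Fin.cons_zero]; linarith
    · simpa only [d, Fin.cons_succ] using hη'
  have key := formCone_const_mul (formCone_of_dominant hl hS hd)
    (show (0 : ℝ) ≤ 1 / (q : ℝ) ^ 2 by positivity)
  convert key using 1
  ext x
  let y : Fin (N + 1) → ℝ := Fin.cons ((x 0 : ℝ) + ∑ i, w i * (x i.succ : ℝ)) (fun i => x i.succ)
  have hy : ∀ i, (linForm (l i) x : ℝ) = q * y i := by
    intro i
    refine Fin.cases ?_ (fun i => ?_) i
    · simp only [l, linForm, Fin.cons_zero, Fin.sum_univ_succ, Fin.cons_succ, y, mul_add,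
        Finset.mul_sum]
      push_cast
      congr 1
      refine Finset.sum_congr rfl fun i _ => ?_
      simp only [w]; field_simp
    · simp [l, linForm, Pi.single_apply, y]
  have hquad : ∀ γ : Fin (N + 1) → ℝ,
      ∑ i, ∑ j, γ i * γ j * (y i * y j) = (∑ i, γ i * y i) ^ 2 := fun γ => by
    rw [sq, Finset.sum_mul_sum]
    exact Finset.sum_congr rfl fun i _ => Finset.sum_congr rfl fun j _ => by ring
  have hSS : ∑ i, ∑ j, S i j * (y i * y j)
      = (∑ i, α i * y i) ^ 2 - (∑ i, e i * y i) ^ 2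
        - 1 / q * ((∑ i, β i * y i) ^ 2 - (∑ i, e i * y i) ^ 2) := by
    rw [← hquad, ← hquad, ← hquad]
    simp only [S, sub_mul, mul_sub, Finset.sum_sub_distrib, Finset.mul_sum, mul_assoc]
  have hα : ∑ i, α i * y i = (x 0 : ℝ) + ∑ i, u i * (x i.succ : ℝ) := by
    simp only [α, y, Fin.sum_univ_succ, Fin.cons_zero, Fin.cons_succ, δ, sub_mul,
      Finset.sum_sub_distrib]
    ring
  have he : ∑ i, e i * y i = y 0 := by
    simp [e, Fin.sum_univ_succ]
  have hβ : ∑ i, β i * y i = x 0 := by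
    simp [β, y, Fin.sum_univ_succ]
  have hdd : ∑ i, d i * y i ^ 2 = (1 - 1 / q) * y 0 ^ 2
      + (η - 1 / q) * ∑ i : Fin N, (x i.succ : ℝ) ^ 2 := by
    simp only [d, y, Fin.sum_univ_succ, Fin.cons_zero, Fin.cons_succ, Finset.mul_sum]
  have hsc : 1 / (q : ℝ) ^ 2 * (∑ i, ∑ j, S i j * (linForm (l i) x * linForm (l j) x)
      + ∑ i, d i * ((linForm (l i) x : ℤ) : ℝ) ^ 2)
      = ∑ i, ∑ j, S i j * (y i * y j) + ∑ i, d i * y i ^ 2 := by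
    simp only [hy, mul_add, Finset.mul_sum]
    congr 1
    · refine Finset.sum_congr rfl fun i _ => Finset.sum_congr rfl fun j _ => ?_
      field_simp
    · refine Finset.sum_congr rfl fun i _ => ?_
      field_simp
  rw [hsc, hSS, hα, he, hβ, hdd, Fin.sum_univ_succ (fun i => (x i : ℝ) ^ 2)]
  ring

/-! ### Minimal vectors, projection along them, and reduction by induction on the rank. -/

section
variable {L : Type*} [AddCommGroup L]

theorem exists_minimal_vector [Nontrivial L] {b : LinearMap.BilinForm ℤ L}
    (pos : ∀ x, x ≠ 0 → 0 < b x x) : ∃ v, v ≠ 0 ∧ ∀ x, x ≠ 0 → b v v ≤ b x x := by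
  obtain ⟨x0, hx0⟩ := exists_ne (0 : L)
  obtain ⟨v, hv, hmin⟩ := WellFounded.has_min (measure fun x : L => (b x x).toNat).wf
    {x | x ≠ 0} ⟨x0, hx0⟩
  refine ⟨v, hv, fun x hx => ?_⟩
  have h1 : ¬ (b x x).toNat < (b v v).toNat := hmin x hx
  have h2 := pos x hx
  omega

/-- A minimal vector is primitive: if the values of functionals at v generate the ideal (g), then v
= g·w, and minimality forces g = ±1. -/
theorem exists_dual_apply_eq_one [Module.Free ℤ L] [Module.Finite ℤ L]
    {b : LinearMap.BilinForm ℤ L} (pos : ∀ x, x ≠ 0 → 0 < b x x) {v : L} (hv : v ≠ 0)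
    (hmin : ∀ x, x ≠ 0 → b v v ≤ b x x) : ∃ f : L →ₗ[ℤ] ℤ, f v = 1 := by
  obtain ⟨g, hg⟩ := IsPrincipalIdealRing.principal
    (LinearMap.range (LinearMap.applyₗ v : (L →ₗ[ℤ] ℤ) →ₗ[ℤ] ℤ))
  let e := Module.Free.chooseBasis ℤ L
  have hdiv : ∀ f : L →ₗ[ℤ] ℤ, ∃ c : ℤ, f v = c * g := fun f => by
    have : f v ∈ Submodule.span ℤ {g} := hg ▸ ⟨f, rfl⟩
    obtain ⟨c, hc⟩ := Submodule.mem_span_singleton.1 this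
    exact ⟨c, by rw [← hc, smul_eq_mul]⟩
  choose c hc using fun i => hdiv (e.coord i)
  have hv' : v = g • ∑ i, c i • e i := by
    rw [← e.sum_repr v, Finset.smul_sum]
    refine Finset.sum_congr rfl fun i _ => ?_
    rw [smul_smul, mul_comm, ← hc]; simp
  obtain ⟨w, hw⟩ : ∃ w, w = ∑ i, c i • e i := ⟨_, rfl⟩
  rw [← hw] at hv'
  have hw0 : w ≠ 0 := fun h => hv (by rw [hv', h, smul_zero])
  have h1 := hmin w hw0
  have h2 := pos w hw0
  have h3 : b v v = g * g * b w w := by rw [hv']; simp; ring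
  have h4 : g ≠ 0 := fun h => hv (by rw [hv', h, zero_smul])
  have h5 : g * g ≤ 1 := by nlinarith
  have h6 : g = 1 ∨ g = -1 := by
    have : g ≤ 1 := by nlinarith
    have : -1 ≤ g := by nlinarith
    omega
  have hgm : g ∈ LinearMap.range (LinearMap.applyₗ v : (L →ₗ[ℤ] ℤ) →ₗ[ℤ] ℤ) :=
    hg ▸ Submodule.mem_span_singleton_self g
  obtain ⟨f, hf⟩ := hgm
  have hf' : f v = g := hf
  rcases h6 with h6 | h6
  · exact ⟨f, by rw [hf', h6]⟩
  · exact ⟨-f, by rw [LinearMap.neg_apply, hf', h6]; norm_num⟩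

/-- Project out `v`: the form `b v v * b x y - b v x * b v y`. -/
def projectedForm (b : LinearMap.BilinForm ℤ L) (v : L) : LinearMap.BilinForm ℤ L :=
  b v v • b - LinearMap.BilinForm.linMulLin (b v) (b v)

theorem projectedForm_apply (b : LinearMap.BilinForm ℤ L) (v x y : L) :
    projectedForm b v x y = b v v * b x y - b v x * b v y := by
  simp [projectedForm, LinearMap.BilinForm.linMulLin_apply]

theorem projectedForm_sub_smul {b : LinearMap.BilinForm ℤ L} (symm : ∀ x y, b x y = b y x)
    (v x : L) (j : ℤ) : projectedForm b v (x - j • v) (x - j • v) = projectedForm b v x x := by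
  simp only [projectedForm_apply, map_sub, map_smul, LinearMap.sub_apply, LinearMap.smul_apply,
    smul_eq_mul, symm x v]
  ring

/-- Subtracting a multiple of v does not change the projected form and achieves |b(v,x)| ≤ m/2,
where m = b(v,v). Since b(x,x) ≥ m still holds, m·b(x,x) − b(v,x)² ≥ m² − m²/4. -/
theorem le_projectedForm {b : LinearMap.BilinForm ℤ L} (symm : ∀ x y, b x y = b y x)
    (pos : ∀ x, x ≠ 0 → 0 < b x x) {v : L} (hv : v ≠ 0)
    (hmin : ∀ x, x ≠ 0 → b v v ≤ b x x) {x : L} (hx : ∀ j : ℤ, x ≠ j • v) :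
    3 * b v v ^ 2 ≤ 4 * projectedForm b v x x := by
  have hm : (0 : ℚ) < b v v := by exact_mod_cast pos v hv
  obtain ⟨j, hj⟩ : ∃ j : ℤ, j = round ((b v x : ℚ) / b v v) := ⟨_, rfl⟩
  have h1 : |(b v x : ℚ) / b v v - j| ≤ 1 / 2 := by rw [hj]; exact abs_sub_round _
  have h2 : (b v x : ℚ) / b v v - j = (b v x - j * b v v : ℤ) / b v v := by
    push_cast; field_simp
  rw [h2, abs_div, abs_of_pos hm, div_le_div_iff₀ hm two_pos] at h1
  have h3 : |b v x - j * b v v| * 2 ≤ 1 * b v v := by exact_mod_cast h1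
  have h4 := hmin (x - j • v) (sub_ne_zero.2 (hx j))
  rw [← projectedForm_sub_smul symm v x j, projectedForm_apply]
  have h5 : b v (x - j • v) = b v x - j * b v v := by simp
  have h6 : |b v (x - j • v)| * 2 ≤ b v v := by rw [h5]; linarith
  have h7 : (b v (x - j • v)) ^ 2 * 4 ≤ b v v ^ 2 := by
    have := pow_le_pow_left₀ (by positivity) h6 2
    rw [mul_pow, sq_abs] at this
    linarith
  nlinarith [pos v hv]

/-- The shear `x ↦ x - J x • v` attached to a functional `J` vanishing at `v`. -/
def shear (J : L →ₗ[ℤ] ℤ) (v : L) (hJ : J v = 0) : L ≃ₗ[ℤ] L :=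
  { (LinearMap.id - J.smulRight v : L →ₗ[ℤ] L) with
    invFun := fun x => x + J x • v
    left_inv := fun x => by simp [hJ]
    right_inv := fun x => by simp [hJ] }

theorem shear_apply (J : L →ₗ[ℤ] ℤ) (v : L) (hJ : J v = 0) (x : L) :
    shear J v hJ x = x - J x • v := rfl

end

open Module in
/-- Every positive definite integral form has a basis in which it is a nonnegative combination of
squares of linear forms from a fixed finite set; moreover a fixed proportion of the minimum times
the sum of the squares of the coordinates can be split off. -/
theorem exists_basis_mem_formCone_aux (n : ℕ) : ∃ (T : ℤ) (ε : ℝ), 1 ≤ T ∧ 0 < ε ∧ ε ≤ 1 ∧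
    ∀ (L : Type) [AddCommGroup L] [Module.Free ℤ L] [Module.Finite ℤ L]
      (b : LinearMap.BilinForm ℤ L), finrank ℤ L = n → (∀ x y, b x y = b y x) →
      (∀ x, x ≠ 0 → 0 < b x x) → ∀ μ : ℝ, (∀ x, x ≠ 0 → μ ≤ b x x) →
      ∃ e : Basis (Fin n) ℤ L, (fun x : Fin n → ℤ =>
        (b (e.equivFun.symm x) (e.equivFun.symm x) : ℝ) - ε * μ * ∑ i, (x i : ℝ) ^ 2)
          ∈ formCone n T := by
  induction n with
  | zero =>
    refine ⟨1, 1, le_rfl, one_pos, le_rfl, fun L _ _ _ b hL _ _ μ _ => ?_⟩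
    refine ⟨Module.finBasisOfFinrankEq ℤ L hL, ?_⟩
    convert (formCone 0 1).zero_mem using 1
    ext x
    simp
  | succ n ih =>
    obtain ⟨T', ε', hT', hε', hε1', ih⟩ := ih
    -- The projected form has minimum at least (3/4)m², m being the norm of the minimal vector. The
    -- induction hypothesis thus splits off η·m² times the sum of squares, and dividing by m leaves
    -- η·m for the shear step.
    let η : ℝ := 3 / 4 * ε'
    have hη : 0 < η := by positivity
    have hη1 : η ≤ 1 := by simp only [η]; linarith
    obtain ⟨q, hq⟩ := exists_nat_gt (3 * (n + 1) / η)
    rw [div_lt_iff₀ hη] at hq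
    have hq0 : 0 < q := by
      rcases Nat.eq_zero_or_pos q with h | h
      · rw [h] at hq; push_cast at hq; rw [zero_mul] at hq; exfalso; linarith [(Nat.cast_nonneg n : (0:ℝ) ≤ n)]
      · exact h
    have hq0' : (0 : ℝ) < q := by exact_mod_cast hq0
    refine ⟨max T' (2 * q), 1 / q, le_max_of_le_left hT', by positivity, ?_, ?_⟩
    · rw [div_le_one hq0']; exact_mod_cast hq0
    intro L _ _ _ b hL symm pos μ hμ
    have : Nontrivial L := Module.nontrivial_of_finrank_pos (R := ℤ) (by omega)
    obtain ⟨v, hv, hmin⟩ := exists_minimal_vector pos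
    obtain ⟨φ, hφ⟩ := exists_dual_apply_eq_one pos hv hmin
    let N := LinearMap.ker φ
    have hN : finrank ℤ N = n := by
      have h1 := LinearMap.rank_range_add_rank_ker φ
      have h2 : LinearMap.range φ = ⊤ := LinearMap.range_eq_top.2 fun c => ⟨c • v, by simp [hφ]⟩
      rw [h2, rank_top, rank_self, ← finrank_eq_rank ℤ L, ← finrank_eq_rank ℤ (LinearMap.ker φ),
        hL] at h1
      have h3 : 1 + finrank ℤ (LinearMap.ker φ) = n + 1 := by exact_mod_cast h1
      simp only [N]; omega
    have hNv : ∀ y : N, y ≠ 0 → ∀ j : ℤ, (y : L) ≠ j • v := by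
      intro y hy j h
      have h1 : φ y = 0 := y.2
      rw [h, map_smul, hφ, smul_eq_mul, mul_one] at h1
      exact hy (Subtype.ext (by rw [h, h1, zero_smul]; rfl))
    let b' : LinearMap.BilinForm ℤ N := (projectedForm b v).restrict N
    have hb' : ∀ x y : N, b' x y = projectedForm b v x y := fun x y => rfl
    have hm : 0 < b v v := pos v hv
    have hmR : (0 : ℝ) < b v v := by exact_mod_cast hm
    have hlow : ∀ y : N, y ≠ 0 → 3 * b v v ^ 2 ≤ 4 * b' y y := fun y hy =>
      le_projectedForm symm pos hv hmin (hNv y hy)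
    obtain ⟨f, hf⟩ := ih N b' hN
      (fun x y => by rw [hb', hb', projectedForm_apply, projectedForm_apply, symm x]; ring)
      (fun y hy => by have := hlow y hy; nlinarith) (3 / 4 * (b v v : ℝ) ^ 2)
      (fun y hy => by
        have : (3 * b v v ^ 2 : ℝ) ≤ 4 * b' y y := by exact_mod_cast hlow y hy
        linarith)
    let e0 : Basis (Fin (n + 1)) ℤ L := Basis.mkFinCons v f
      (fun c x hx h => by
        have h1 : φ (c • v + x) = 0 := by rw [h, map_zero]
        have h2 : φ x = 0 := hx
        rw [map_add, map_smul, hφ, h2] at h1; simpa using h1)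
      (fun z => ⟨- φ z, by
        change φ _ = 0
        rw [map_add, map_smul, hφ]; simp⟩)
    have he0 : ∀ i, e0 i = (Fin.cons v (fun i => (f i : L)) : Fin (n + 1) → L) i := fun i => by
      simp only [e0, Basis.coe_mkFinCons]; rfl
    -- Shearing the lifted basis by these nearest integers brings the coefficients b(v,·)/b(v,v)
    -- into [−1/2, 1/2] and leaves the projected form unchanged.
    let k : Fin n → ℤ := fun i => round ((b v (f i) : ℝ) / b v v)
    let u : Fin n → ℝ := fun i => (b v (f i) : ℝ) / b v v - k i
    have hu : ∀ i, |u i| ≤ 1 / 2 := fun i => abs_sub_round _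
    let J : L →ₗ[ℤ] ℤ := e0.constr ℤ (Fin.cons 0 k : Fin (n + 1) → ℤ)
    have hJ0 : J v = 0 := by
      have := e0.constr_basis ℤ (Fin.cons 0 k : Fin (n + 1) → ℤ) 0
      rw [he0] at this; exact this
    have hJ1 : ∀ i, J (f i) = k i := fun i => by
      have := e0.constr_basis ℤ (Fin.cons 0 k : Fin (n + 1) → ℤ) i.succ
      rw [he0] at this; exact this
    let e : Basis (Fin (n + 1)) ℤ L := e0.map (shear J v hJ0)
    refine ⟨e, ?_⟩
    have hcone1 := formCone_const_mul (formCone_shear (N := n) hη1 hq0 hq.le hu) hmR.le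
    have hcone2 := formCone_const_mul (formCone_tail (by omega) hf)
      (show 0 ≤ 1 / (b v v : ℝ) by positivity)
    -- The shear step splits off b(v,v)/q times the sum of squares, but only μ/q is required; the
    -- surplus goes back into the cone.
    have hcone3 := formCone_sum_sq (n := n + 1) (T := max T' (2 * q)) (le_max_of_le_left hT')
      (c := 1 / q * (b v v - μ)) (by have := hμ v hv; apply mul_nonneg <;> [positivity; linarith])
    convert formCone_add (formCone_add (formCone_mono _ (le_max_right T' _) hcone1)
      (formCone_mono _ (le_max_left _ (2 * q : ℤ)) hcone2)) hcone3 using 1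
    ext x
    let y : N := f.equivFun.symm (fun i => x i.succ)
    have hy : (y : L) = ∑ i, x (Fin.succ i) • (f i : L) := by
      simp [y, Basis.equivFun_symm_apply]
    let z : L := e.equivFun.symm x
    have hz : z = ((y : L) - J y • v) + x 0 • v := by
      have h1 : z = ∑ i, x i • e i := Basis.equivFun_symm_apply _ _
      rw [h1, Fin.sum_univ_succ, hy, map_sum, Finset.sum_smul, ← Finset.sum_sub_distrib, add_comm]
      congr 1
      · refine Finset.sum_congr rfl fun i _ => ?_
        rw [show e i.succ = shear J v hJ0 (e0 i.succ) from Basis.map_apply _ _ _, he0, shear_apply]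
        simp [smul_sub, hJ1, smul_smul]
      · rw [show e 0 = shear J v hJ0 (e0 0) from Basis.map_apply _ _ _, he0, shear_apply]
        simp [hJ0]
    have hproj : projectedForm b v z z = b' y y := by
      rw [hb', hz, ← projectedForm_sub_smul symm v (y : L) (J y - x 0)]
      congr 2 <;> (rw [sub_smul]; abel)
    have hbvz : (b v z : ℝ) = b v v * ((x 0 : ℝ) + ∑ i, u i * (x (Fin.succ i) : ℝ)) := by
      have h1 : b v z = ∑ i, x (Fin.succ i) * (b v (f i) - k i * b v v) + x 0 * b v v := by
        rw [hz, hy]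
        simp only [map_add, map_sub, map_sum, map_smul, smul_eq_mul, hJ1, Finset.sum_mul, mul_sub,
          Finset.sum_sub_distrib, mul_assoc]
      rw [h1]
      push_cast
      rw [mul_add, Finset.mul_sum, add_comm]
      congr 1
      · ring
      · refine Finset.sum_congr rfl fun i _ => ?_
        simp only [u]; field_simp
    have hbz : (b v v : ℝ) * b z z = (b v z : ℝ) ^ 2 + b' y y := by
      rw [← hproj, projectedForm_apply]; push_cast; ring
    have hbz' : (b z z : ℝ) = b v v * ((x 0 : ℝ) + ∑ i, u i * (x (Fin.succ i) : ℝ)) ^ 2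
        + 1 / b v v * b' y y := by
      have : (b z z : ℝ) = 1 / b v v * (b v v * b z z) := by field_simp
      rw [this, hbz, hbvz]; field_simp
    change (b z z : ℝ) - _ = _
    rw [hbz']
    simp only [η]
    change _ = _ + 1 / (b v v : ℝ) * ((b' y y : ℝ) - _) + _
    field_simp
    ring

open Module in
theorem exists_basis_gram_eq_sum (n : ℕ) : ∃ T : ℤ, ∀ (L : Type) [AddCommGroup L]
    [Module.Free ℤ L] [Module.Finite ℤ L] (b : LinearMap.BilinForm ℤ L), finrank ℤ L = n →
      (∀ x y, b x y = b y x) → (∀ x, x ≠ 0 → 0 < b x x) →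
      ∃ (e : Basis (Fin n) ℤ L) (c : (Fin n → Finset.Icc (-T) T) → NNReal),
        ∀ i j, (b (e i) (e j) : ℝ) = ∑ l, (c l : ℝ) * ((l i : ℤ) * (l j : ℤ)) := by
  obtain ⟨T, ε, -, -, -, H⟩ := exists_basis_mem_formCone_aux n
  refine ⟨T, fun L _ _ _ b hL symm pos => ?_⟩
  -- With μ = 0 the split-off term, needed only for the induction, vanishes.
  obtain ⟨e, he⟩ := H L b hL symm pos 0 fun x hx => by exact_mod_cast (pos x hx).le
  have hrange : {f : (Fin n → ℤ) → ℝ | ∃ l : Fin n → ℤ, (∀ i, |l i| ≤ T) ∧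
      f = fun x => ((linForm l x : ℤ) : ℝ) ^ 2} = Set.range
        (fun (l : Fin n → Finset.Icc (-T) T) (x : Fin n → ℤ) =>
          ((linForm (fun i => (l i : ℤ)) x : ℤ) : ℝ) ^ 2) := by
    ext f
    constructor
    · rintro ⟨l, hl, rfl⟩
      exact ⟨fun i => ⟨l i, Finset.mem_Icc.2 (abs_le.1 (hl i))⟩, rfl⟩
    · rintro ⟨l, rfl⟩
      exact ⟨fun i => l i, fun i => abs_le.2 (Finset.mem_Icc.1 (l i).2), rfl⟩
  rw [formCone, hrange, Submodule.mem_span_range_iff_exists_fun] at he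
  obtain ⟨c, hc⟩ := he
  have hc' : ∀ x, (b (e.equivFun.symm x) (e.equivFun.symm x) : ℝ)
      = ∑ l, (c l : ℝ) * ((linForm (fun i => (l i : ℤ)) x : ℤ) : ℝ) ^ 2 := fun x => by
    have := congrFun hc x
    simp only [Finset.sum_apply, Pi.smul_apply, mul_zero, zero_mul, sub_zero] at this
    rw [← this]; rfl
  refine ⟨e, c, fun i j => ?_⟩
  have hs : ∀ i, e i = e.equivFun.symm (Pi.single i 1) := fun i => by
    simp [Basis.equivFun_symm_apply, Pi.single_apply]
  have hlin : ∀ (l : Fin n → ℤ) i, linForm l (Pi.single i 1) = l i := fun l i => by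
    simp [linForm, Pi.single_apply]
  have hlin2 : ∀ (l x y : Fin n → ℤ), linForm l (x + y) = linForm l x + linForm l y := fun l x y => by
    simp [linForm, mul_add, Finset.sum_add_distrib]
  have h1 := hc' (Pi.single i 1)
  have h2 := hc' (Pi.single j 1)
  have h3 := hc' (Pi.single i 1 + Pi.single j 1)
  have h4 : b (e i + e j) (e i + e j) = b (e i) (e i) + b (e j) (e j) + 2 * b (e i) (e j) := by
    simp only [map_add, LinearMap.add_apply, symm (e j) (e i)]; ring
  rw [map_add, ← hs, ← hs, h4] at h3
  rw [← hs] at h1 h2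
  push_cast at h3
  rw [h1, h2] at h3
  simp only [hlin2, hlin] at h3
  have h5 : (2 : ℝ) * b (e i) (e j) = 2 * ∑ l, (c l : ℝ) * ((l i : ℤ) * (l j : ℤ)) := by
    rw [eq_comm, ← sub_eq_iff_eq_add'] at h3
    rw [← h3, ← Finset.sum_add_distrib, ← Finset.sum_sub_distrib, Finset.mul_sum]
    refine Finset.sum_congr rfl fun l _ => ?_
    push_cast; ring
  linarith

/-! ### Integral vectors orthogonal to a given system, via quaternion multiplication -/

open Matrix

/-- Left multiplication by the quaternion `c` on `h`-tuples of quaternions in coordinates. -/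
def quatMul {h : ℕ} (c : Fin 4 → ℤ) : (Fin h × Fin 4 → ℤ) →ₗ[ℤ] (Fin h × Fin 4 → ℤ) where
  toFun z p := ![c 0 * z (p.1, 0) - c 1 * z (p.1, 1) - c 2 * z (p.1, 2) - c 3 * z (p.1, 3),
    c 0 * z (p.1, 1) + c 1 * z (p.1, 0) + c 2 * z (p.1, 3) - c 3 * z (p.1, 2),
    c 0 * z (p.1, 2) - c 1 * z (p.1, 3) + c 2 * z (p.1, 0) + c 3 * z (p.1, 1),
    c 0 * z (p.1, 3) + c 1 * z (p.1, 2) - c 2 * z (p.1, 1) + c 3 * z (p.1, 0)] p.2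
  map_add' z w := by
    ext ⟨a, k⟩
    fin_cases k <;> simp <;> ring
  map_smul' m z := by
    ext ⟨a, k⟩
    fin_cases k <;> simp <;> ring

theorem quatMul_dotProduct_self {h : ℕ} (c : Fin 4 → ℤ) (z : Fin h × Fin 4 → ℤ) :
    quatMul c z ⬝ᵥ quatMul c z = (c 0 ^ 2 + c 1 ^ 2 + c 2 ^ 2 + c 3 ^ 2) * (z ⬝ᵥ z) := by
  simp only [dotProduct, Fintype.sum_prod_type, Fin.sum_univ_four, Finset.mul_sum]
  refine Finset.sum_congr rfl fun a _ => ?_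
  simp [quatMul]
  ring

theorem quatMul_dotProduct {h : ℕ} (c : Fin 4 → ℤ) (z y : Fin h × Fin 4 → ℤ) :
    quatMul c z ⬝ᵥ y = ∑ k, c k * (quatMul (Pi.single k 1) z ⬝ᵥ y) := by
  simp only [dotProduct, Fintype.sum_prod_type, Fin.sum_univ_four, Finset.mul_sum,
    ← Finset.sum_add_distrib]
  refine Finset.sum_congr rfl fun a _ => ?_
  simp [quatMul]
  ring

/-- The quaternionic orthogonal complement of the vectors `y i`. -/
def quatOrthogonal {h n : ℕ} (y : Fin n → Fin h × Fin 4 → ℤ) : Submodule ℤ (Fin h × Fin 4 → ℤ) :=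
  LinearMap.ker (LinearMap.pi fun p : Fin n × Fin 4 =>
    (dotProductBilin ℤ ℤ (y p.1)).comp (quatMul (h := h) (Pi.single p.2 1)))

theorem mem_quatOrthogonal {h n : ℕ} {y : Fin n → Fin h × Fin 4 → ℤ} {z : Fin h × Fin 4 → ℤ} :
    z ∈ quatOrthogonal y ↔ ∀ i k, quatMul (Pi.single k 1) z ⬝ᵥ y i = 0 := by
  simp [quatOrthogonal, funext_iff, dotProduct_comm]

/-- Multiply z by a quaternion of norm m, which exists by the four squares theorem. Orthogonality
survives because the product is an integral combination of the multiples of z by the four units. -/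
theorem exists_orthogonal_of_mem_quatOrthogonal {h n : ℕ} {y : Fin n → Fin h × Fin 4 → ℤ}
    {z : Fin h × Fin 4 → ℤ} (hz : z ∈ quatOrthogonal y) (m : ℕ) :
    ∃ w : Fin h × Fin 4 → ℤ, (∀ i, w ⬝ᵥ y i = 0) ∧ w ⬝ᵥ w = m * (z ⬝ᵥ z) := by
  obtain ⟨a, b, c, d, h4⟩ := Nat.sum_four_squares m
  refine ⟨quatMul ![a, b, c, d] z, fun i => ?_, ?_⟩
  · rw [quatMul_dotProduct]
    exact Finset.sum_eq_zero fun k _ => by rw [mem_quatOrthogonal.1 hz, mul_zero]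
  · rw [quatMul_dotProduct_self, ← h4]
    simp

theorem le_finrank_quatOrthogonal {h n : ℕ} (y : Fin n → Fin h × Fin 4 → ℤ) :
    4 * h ≤ Module.finrank ℤ (quatOrthogonal y) + 4 * n := by
  obtain ⟨f, hf⟩ : ∃ f : (Fin h × Fin 4 → ℤ) →ₗ[ℤ] (Fin n × Fin 4 → ℤ),
      LinearMap.ker f = quatOrthogonal y := ⟨_, rfl⟩
  rw [← hf]
  have h1 := LinearMap.rank_range_add_rank_ker f
  rw [← Module.finrank_eq_rank ℤ (Fin h × Fin 4 → ℤ), ← Module.finrank_eq_rank ℤ (LinearMap.ker f),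
    ← Module.finrank_eq_rank ℤ (LinearMap.range f)] at h1
  have h2 : Module.finrank ℤ (LinearMap.range f) + Module.finrank ℤ (LinearMap.ker f)
      = Module.finrank ℤ (Fin h × Fin 4 → ℤ) := by exact_mod_cast h1
  have h3 := Submodule.finrank_le (LinearMap.range f)
  simp only [Module.finrank_fintype_fun_eq_card, Fintype.card_prod, Fintype.card_fin] at h2 h3
  omega

/-- A saturated submodule of `ℤ^ι` of rank more than half is not totally isotropic modulo `p`. -/
theorem exists_not_dvd_dotProduct {ι : Type*} [Fintype ι] {Λ : Submodule ℤ (ι → ℤ)} {p : ℕ}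
    (hp : p.Prime) (hsat : ∀ w, (p : ℤ) • w ∈ Λ → w ∈ Λ)
    (hrank : Fintype.card ι < 2 * Module.finrank ℤ Λ) :
    ∃ z ∈ Λ, ∃ w ∈ Λ, ¬ (p : ℤ) ∣ z ⬝ᵥ w := by
  by_contra! hcon
  have : Fact p.Prime := ⟨hp⟩
  let s := Module.finrank ℤ Λ
  let e : Module.Basis (Fin s) ℤ Λ := Module.finBasis ℤ Λ
  let A : Matrix ι (Fin s) (ZMod p) := Matrix.of fun i j => (((e j : ι → ℤ) i : ℤ) : ZMod p)
  have hA : Aᵀ * A = 0 := by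
    ext i j
    have h1 := hcon (e i) (e i).2 (e j) (e j).2
    rw [← ZMod.intCast_zmod_eq_zero_iff_dvd] at h1
    rw [Matrix.mul_apply, Matrix.zero_apply, ← h1]
    simp [A, dotProduct]
  -- Saturation at p keeps the basis of Λ independent modulo p, so A has rank s, whereas AᵀA = 0
  -- would give 2s ≤ card ι.
  have hinj : Function.Injective A.mulVecLin := by
    rw [← LinearMap.ker_eq_bot, LinearMap.ker_eq_bot']
    intro c hc
    choose C hC using fun j => ZMod.intCast_surjective (c j)
    have h1 : ∀ i, (p : ℤ) ∣ ∑ j, C j * (e j : ι → ℤ) i := fun i => by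
      rw [← ZMod.intCast_zmod_eq_zero_iff_dvd]
      have h2 := congrFun hc i
      simp only [Matrix.mulVecLin_apply, Matrix.mulVec, dotProduct, A, Matrix.of_apply,
        Pi.zero_apply] at h2
      push_cast
      rw [← h2]
      exact Finset.sum_congr rfl fun j _ => by rw [hC, mul_comm]
    choose w hw using h1
    have h2 : ((∑ j, C j • e j : Λ) : ι → ℤ) = (p : ℤ) • w := by
      ext i
      simp only [Submodule.coe_sum, Submodule.coe_smul, Finset.sum_apply, Pi.smul_apply,
        smul_eq_mul]
      exact hw i
    have h3 : w ∈ Λ := hsat w (h2 ▸ Subtype.coe_prop _)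
    have h4 : ∑ j, C j • e j = (p : ℤ) • (⟨w, h3⟩ : Λ) := Subtype.ext h2
    ext j
    have h5 := congrArg (fun x => e.repr x j) h4
    simp only [map_sum, map_smul, Module.Basis.repr_self, Finsupp.coe_finsetSum, Finset.sum_apply,
      Finsupp.smul_apply, Finsupp.single_apply, smul_eq_mul, mul_ite, mul_one, mul_zero,
      Finset.sum_ite_eq', Finset.mem_univ, if_true] at h5
    rw [← hC, h5]
    simp
  have hr : A.rank = s := by
    rw [Matrix.rank, LinearMap.finrank_range_of_inj hinj]; simp
  have := Matrix.rank_add_rank_le_card_of_mul_eq_zero hA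
  rw [Matrix.rank_transpose, hr] at this
  omega

/-- Polarization: if z·z, w·w and (z+w)·(z+w) were all divisible, so would be 2(z·w). At p = 2 the
extra factor 2 is why 4 is used as the modulus. -/
theorem exists_not_dvd_dotProduct_self {ι : Type*} [Fintype ι] {Λ : Submodule ℤ (ι → ℤ)} {p : ℕ}
    (hp : p.Prime) (hsat : ∀ w, (p : ℤ) • w ∈ Λ → w ∈ Λ)
    (hrank : Fintype.card ι < 2 * Module.finrank ℤ Λ) :
    ∃ z ∈ Λ, ¬ ((if p = 2 then 4 else p : ℕ) : ℤ) ∣ z ⬝ᵥ z := by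
  obtain ⟨z, hz, w, hw, hzw⟩ := exists_not_dvd_dotProduct hp hsat hrank
  by_contra! hcon
  have h1 := hcon z hz
  have h2 := hcon w hw
  have h3 := hcon (z + w) (Λ.add_mem hz hw)
  have h4 : (z + w) ⬝ᵥ (z + w) = z ⬝ᵥ z + w ⬝ᵥ w + 2 * (z ⬝ᵥ w) := by
    simp only [add_dotProduct, dotProduct_add, dotProduct_comm w z]; ring
  rw [h4] at h3
  have h5 := (dvd_add_right (dvd_add h1 h2)).1 h3
  apply hzw
  split_ifs at h5 with hp2
  · subst hp2
    push_cast at h5 ⊢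
    omega
  · refine IsCoprime.dvd_of_dvd_mul_left ?_ h5
    exact (Nat.isCoprime_iff_coprime (n := 2)).2 ((Nat.coprime_primes hp Nat.prime_two).2 hp2)

theorem exists_forall_not_dvd_dotProduct_self {ι : Type*} [Fintype ι] {Λ : Submodule ℤ (ι → ℤ)}
    (hsat : ∀ (p : ℤ) w, p ≠ 0 → p • w ∈ Λ → w ∈ Λ)
    (hrank : Fintype.card ι < 2 * Module.finrank ℤ Λ) (P : Finset ℕ) (hP : ∀ p ∈ P, p.Prime) :
    ∃ z ∈ Λ, ∀ p ∈ P, ¬ ((if p = 2 then 4 else p : ℕ) : ℤ) ∣ z ⬝ᵥ z := by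
  classical
  induction P using Finset.induction_on with
  | empty => exact ⟨0, Λ.zero_mem, by simp⟩
  | insert p P hpP ih =>
    obtain ⟨z, hz, hzP⟩ := ih fun q hq => hP q (Finset.mem_insert_of_mem hq)
    have hp : p.Prime := hP p (Finset.mem_insert_self p P)
    obtain ⟨w, hw, hwp⟩ := exists_not_dvd_dotProduct_self hp
      (fun w => hsat p w (by exact_mod_cast hp.ne_zero)) hrank
    -- In the norm of p·z + M·w only M²(w·w) survives modulo p (or 4 if p = 2), and only p²(z·z)
    -- survives at the earlier primes.
    obtain ⟨M, hM⟩ : ∃ M : ℤ, M = ∏ q ∈ P, (q : ℤ) := ⟨_, rfl⟩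
    have hexp : ∀ s t : ℤ, (s • z + t • w) ⬝ᵥ (s • z + t • w)
        = s ^ 2 * (z ⬝ᵥ z) + 2 * s * t * (z ⬝ᵥ w) + t ^ 2 * (w ⬝ᵥ w) := fun s t => by
      simp only [add_dotProduct, dotProduct_add, smul_dotProduct, dotProduct_smul, smul_eq_mul,
        dotProduct_comm w z]
      ring
    have hdvd : ∀ q : ℕ, ∀ s t : ℤ, (q : ℤ) ∣ t →
        ((if q = 2 then 4 else q : ℕ) : ℤ) ∣ 2 * s * t * (z ⬝ᵥ w) ∧
        ((if q = 2 then 4 else q : ℕ) : ℤ) ∣ t ^ 2 := by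
      rintro q s t ⟨t', rfl⟩
      split_ifs with h
      · subst h
        exact ⟨⟨s * t' * (z ⬝ᵥ w), by push_cast; ring⟩, ⟨t' ^ 2, by push_cast; ring⟩⟩
      · exact ⟨⟨2 * s * t' * (z ⬝ᵥ w), by ring⟩, ⟨q * t' ^ 2, by ring⟩⟩
    have hcop : ∀ q : ℕ, q.Prime → ∀ s : ℤ, IsCoprime (q : ℤ) s →
        IsCoprime ((if q = 2 then 4 else q : ℕ) : ℤ) (s ^ 2) := by
      intro q hq s hs
      split_ifs with h
      · subst h
        have : ((4 : ℕ) : ℤ) = ((2 : ℕ) : ℤ) ^ 2 := by norm_num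
        rw [this]
        exact hs.pow
      · exact hs.pow_right
    refine ⟨(p : ℤ) • z + M • w, Λ.add_mem (Λ.smul_mem _ hz) (Λ.smul_mem _ hw), fun q hq => ?_⟩
    rw [hexp]
    rcases Finset.mem_insert.1 hq with rfl | hqP
    · intro h
      apply hwp
      obtain ⟨d1, -⟩ := hdvd q M q dvd_rfl
      obtain ⟨-, d2⟩ := hdvd q 0 q dvd_rfl
      have h1 : ((if q = 2 then 4 else q : ℕ) : ℤ) ∣ M ^ 2 * (w ⬝ᵥ w) := by
        refine (dvd_add_right (dvd_add (d2.mul_right (z ⬝ᵥ z)) ?_)).1 h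
        rwa [show (2 : ℤ) * q * M * (z ⬝ᵥ w) = 2 * M * q * (z ⬝ᵥ w) by ring]
      refine (hcop q hp M ?_).dvd_of_dvd_mul_left h1
      rw [hM]
      refine IsCoprime.prod_right fun r hr => ?_
      refine Nat.isCoprime_iff_coprime.2 ((Nat.coprime_primes hp
        (hP r (Finset.mem_insert_of_mem hr))).2 ?_)
      rintro rfl; exact hpP hr
    · intro h
      apply hzP q hqP
      have hqM : (q : ℤ) ∣ M := hM ▸ Finset.dvd_prod_of_mem (fun q : ℕ => (q : ℤ)) hqP
      obtain ⟨d1, d2⟩ := hdvd q p M hqM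
      have h1 : ((if q = 2 then 4 else q : ℕ) : ℤ) ∣ (p : ℤ) ^ 2 * (z ⬝ᵥ z) := by
        rw [add_assoc] at h
        exact (dvd_add_left (dvd_add d1 (d2.mul_right _))).1 h
      have hqp := hP q hq
      refine (hcop q hqp p ?_).dvd_of_dvd_mul_left h1
      refine Nat.isCoprime_iff_coprime.2 ((Nat.coprime_primes hqp hp).2 ?_)
      rintro rfl; exact hpP hqP

/-- Given two systems of few integral vectors, the sums of the norms of a vector orthogonal to the
first system and a vector orthogonal to the second exhaust all large even numbers. -/
theorem exists_orthogonal_pair_norm {h n : ℕ} (hn : 2 * n < h) (y y' : Fin n → Fin h × Fin 4 → ℤ) :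
    ∃ T : ℕ, ∀ k ≥ T, ∃ z z' : Fin h × Fin 4 → ℤ, (∀ i, z ⬝ᵥ y i = 0) ∧ (∀ i, z' ⬝ᵥ y' i = 0) ∧
      z ⬝ᵥ z + z' ⬝ᵥ z' = 2 * k := by
  have hr := le_finrank_quatOrthogonal y
  have hr' := le_finrank_quatOrthogonal y'
  have hpos : ∀ z : Fin h × Fin 4 → ℤ, 0 ≤ z ⬝ᵥ z := fun z =>
    Finset.sum_nonneg fun i _ => mul_self_nonneg _
  obtain ⟨z1, hz1, hz1'⟩ : ∃ z ∈ quatOrthogonal y, z ≠ 0 := by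
    refine (Submodule.ne_bot_iff _).1 fun h0 => ?_
    rw [h0, finrank_bot] at hr
    omega
  obtain ⟨t1, ht1⟩ := Int.eq_ofNat_of_zero_le (hpos z1)
  have ht1' : t1 ≠ 0 := by
    rintro rfl
    exact hz1' (dotProduct_self_eq_zero.1 (by simpa using ht1))
  obtain ⟨z2, hz2, hz2'⟩ := exists_forall_not_dvd_dotProduct_self (Λ := quatOrthogonal y')
    (fun p w hp hw => by
      rw [mem_quatOrthogonal] at hw ⊢
      intro i k
      have := hw i k
      rw [map_smul, smul_dotProduct, smul_eq_mul] at this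
      exact (mul_eq_zero.1 this).resolve_left hp)
    (by simp only [Fintype.card_prod, Fintype.card_fin]; omega) t1.primeFactors
    (fun p hp => Nat.prime_of_mem_primeFactors hp)
  obtain ⟨t2, ht2⟩ := Int.eq_ofNat_of_zero_le (hpos z2)
  obtain ⟨T, hT⟩ := Nat.exists_mem_closure_of_ge {t1, t2}
  have g1 : Nat.setGcd {t1, t2} ∣ t1 := Nat.setGcd_dvd_of_mem (by simp)
  have g2 : Nat.setGcd {t1, t2} ∣ t2 := Nat.setGcd_dvd_of_mem (by simp)
  -- By the choice of z2, the gcd has no odd prime factor and is not divisible by 4. Hence every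
  -- large even number has the form m1·t1 + m2·t2, and both multiples are norms of orthogonal
  -- vectors.
  have hg : Nat.setGcd {t1, t2} ∣ 2 := by
    obtain ⟨g, hgdef⟩ : ∃ g, g = Nat.setGcd {t1, t2} := ⟨_, rfl⟩
    rw [← hgdef] at g1 g2 ⊢
    have hbad : ∀ p : ℕ, p.Prime → (if p = 2 then 4 else p) ∣ g → False := fun p hp hd => by
      have hpg : p ∣ g := by
        refine dvd_trans ?_ hd
        split_ifs with h
        · subst h; norm_num
        · exact dvd_rfl
      refine hz2' p (Nat.mem_primeFactors.2 ⟨hp, hpg.trans g1, ht1'⟩) ?_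
      rw [ht2]
      exact_mod_cast hd.trans g2
    rcases Nat.eq_two_pow_or_exists_odd_prime_and_dvd g with ⟨k, hk⟩ | ⟨p, hp, hpg, hodd⟩
    · by_cases h2 : k ≤ 1
      · rw [hk]; simpa using pow_dvd_pow 2 h2
      · exact (hbad 2 Nat.prime_two (by
          rw [hk, if_pos rfl]; exact pow_dvd_pow 2 (show 2 ≤ k by omega))).elim
    · refine (hbad p hp ?_).elim
      rwa [if_neg (by rintro rfl; exact absurd hodd (by decide))]
  refine ⟨T, fun k hk => ?_⟩
  have := hT (2 * k) (by omega) (hg.trans (dvd_mul_right 2 k))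
  obtain ⟨m1, m2, hm⟩ := (AddSubmonoid.mem_closure_pair _ _ _).1 this
  obtain ⟨w, hw, hww⟩ := exists_orthogonal_of_mem_quatOrthogonal hz1 m1
  obtain ⟨w', hw', hww'⟩ := exists_orthogonal_of_mem_quatOrthogonal hz2 m2
  refine ⟨w, w', hw, hw', ?_⟩
  rw [hww, hww', ht1, ht2]
  simp only [smul_eq_mul] at hm
  exact_mod_cast hm

/-! ### Orthogonal vectors of equal norm in forms of infinite rank -/

section
variable {M : Type*} [AddCommGroup M]

/-- The `ℤ`-span of the vectors `e i`, `i ∈ I`, contains a vector whose norm, scaled by `σ`, is `c`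
up to a nonzero square. -/
def RepresentsUpToSq (b : LinearMap.BilinForm ℤ M) (σ : ℤ) (e : ℕ → M) (I : Finset ℕ) (c : ℤ) :
    Prop :=
  ∃ x ∈ Submodule.span ℤ (e '' I), ∃ s : ℤ, s ≠ 0 ∧ σ * b x x = c * s ^ 2

theorem apply_eq_zero_of_mem_span {b : LinearMap.BilinForm ℤ M} {s t : Set M}
    (h : ∀ x ∈ s, ∀ y ∈ t, b x y = 0) {x y : M} (hx : x ∈ Submodule.span ℤ s)
    (hy : y ∈ Submodule.span ℤ t) : b x y = 0 := by
  induction hx using Submodule.span_induction with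
  | mem x hx =>
    induction hy using Submodule.span_induction with
    | mem y hy => exact h x hx y hy
    | zero => simp
    | add y y' _ _ h1 h2 => simp [h1, h2]
    | smul c y _ h1 => simp [h1]
  | zero => simp
  | add x x' _ _ h1 h2 => simp [h1, h2]
  | smul c x _ h1 => simp [h1]

theorem apply_eq_zero_of_disjoint {b : LinearMap.BilinForm ℤ M} {e : ℕ → M}
    (orth : ∀ i j, i ≠ j → b (e i) (e j) = 0) {I J : Finset ℕ} (hIJ : Disjoint I J) {x y : M}
    (hx : x ∈ Submodule.span ℤ (e '' I)) (hy : y ∈ Submodule.span ℤ (e '' J)) : b x y = 0 := by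
  refine apply_eq_zero_of_mem_span ?_ hx hy
  rintro _ ⟨i, hi, rfl⟩ _ ⟨j, hj, rfl⟩
  exact orth i j fun h => Finset.disjoint_left.1 hIJ hi (h ▸ hj)

variable {b : LinearMap.BilinForm ℤ M} {σ : ℤ} {e : ℕ → M}

theorem RepresentsUpToSq.combine (symm : ∀ x y, b x y = b y x)
    (orth : ∀ i j, i ≠ j → b (e i) (e j) = 0) {I J : Finset ℕ} (hIJ : Disjoint I J) {a₁ a₂ : ℤ}
    (h₁ : RepresentsUpToSq b σ e I a₁) (h₂ : RepresentsUpToSq b σ e J a₂) {c x y z : ℤ}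
    (hz : z ≠ 0) (h : a₁ * x ^ 2 + a₂ * y ^ 2 = c * z ^ 2) :
    RepresentsUpToSq b σ e (I ∪ J) c := by
  obtain ⟨v, hv, s, hs, hvs⟩ := h₁
  obtain ⟨w, hw, t, ht, hwt⟩ := h₂
  have h0 := apply_eq_zero_of_disjoint orth hIJ hv hw
  refine ⟨(x * t) • v + (y * s) • w, Submodule.add_mem _ (Submodule.smul_mem _ _ ?_)
    (Submodule.smul_mem _ _ ?_), s * t * z, by simp [hs, ht, hz], ?_⟩
  · exact Submodule.span_mono (Set.image_mono (by simp)) hv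
  · exact Submodule.span_mono (Set.image_mono (by simp)) hw
  · simp only [map_add, map_smul, LinearMap.add_apply, LinearMap.smul_apply, smul_eq_mul,
      symm w v, h0]
    linear_combination (x ^ 2 * t ^ 2) * hvs + (y ^ 2 * s ^ 2) * hwt + s ^ 2 * t ^ 2 * h

theorem RepresentsUpToSq.of_mul_sq {I : Finset ℕ} {c d : ℤ} (hd : d ≠ 0)
    (h : RepresentsUpToSq b σ e I (d ^ 2 * c)) : RepresentsUpToSq b σ e I c := by
  obtain ⟨x, hx, s, hs, hxs⟩ := h
  exact ⟨x, hx, d * s, by simp [hd, hs], by rw [hxs]; ring⟩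

/-- Cancelling d² gives c ≡ β' mod 4a. A prime dividing both β' and a would divide d, so its square
would divide the squarefree β. -/
theorem exists_coprime_cofactor {a : ℕ} {β β' d a' t c : ℕ} (hβ : Squarefree β)
    (hd : d = β.gcd a) (hββ' : β = d * β') (ha : a = d * a') (ha0 : 0 < a) (hodd : Odd β)
    (h : (d ^ 2 * c : ℤ) = d ^ 2 * β' + 4 * a ^ 3 * t ∨
      (d ^ 2 * c : ℤ) = d ^ 2 * β' - 4 * a ^ 3 * t) : Odd c ∧ c.Coprime a := by
  have hd0 : (d : ℤ) ≠ 0 := by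
    rintro h0
    have : d = 0 := by exact_mod_cast h0
    rw [this] at ha; omega
  have hc : ∃ k : ℤ, (c : ℤ) = β' + (4 * a) * k := by
    have haZ : (a : ℤ) = d * a' := by exact_mod_cast ha
    rcases h with h | h
    · refine ⟨a' ^ 2 * t, ?_⟩
      apply mul_left_cancel₀ (pow_ne_zero 2 hd0)
      rw [h, haZ]; ring
    · refine ⟨- (a' ^ 2 * t), ?_⟩
      apply mul_left_cancel₀ (pow_ne_zero 2 hd0)
      rw [h, haZ]; ring
  obtain ⟨k, hk⟩ := hc
  have hβ'odd : Odd β' := by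
    rw [hββ'] at hodd; exact (Nat.odd_mul.1 hodd).2
  constructor
  · rw [Nat.odd_iff] at hβ'odd ⊢
    have : (c : ℤ) = β' + 2 * (2 * a * k) := by rw [hk]; ring
    omega
  · have hcop : β'.Coprime a := by
      refine Nat.Coprime.symm (Nat.coprime_of_dvd fun p hp hpa hpβ => ?_)
      have h1 : p ∣ d := hd ▸ Nat.dvd_gcd (hββ' ▸ hpβ.mul_left d) hpa
      have h2 : p * p ∣ β := hββ' ▸ mul_dvd_mul h1 hpβ
      exact hp.one_lt.ne' (Nat.isUnit_iff.1 (hβ p h2))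
    have h1 : IsCoprime (β' : ℤ) a := Nat.isCoprime_iff_coprime.2 hcop
    refine Nat.isCoprime_iff_coprime.1 ?_
    rw [hk, mul_comm 4 (a : ℤ), mul_assoc]
    exact h1.add_mul_left_left _

/-- Choose four indices whose β agree modulo 4a³ and write d = gcd(β, a) as a sum of four squares.
The corresponding combination is ≡ dβ = d²β' mod 4a³, hence equals d²c with c odd and prime to a,
and the square d² may be dropped. -/
theorem exists_coprime_represented (symm : ∀ x y, b x y = b y x)
    (orth : ∀ i j, i ≠ j → b (e i) (e j) = 0) {𝓘 : Set ℕ} (h𝓘 : 𝓘.Infinite) {β : ℕ → ℕ}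
    (hβ : ∀ i ∈ 𝓘, Squarefree (β i)) (hodd : ∀ i ∈ 𝓘, Odd (β i))
    (hrep : ∀ i ∈ 𝓘, RepresentsUpToSq b σ e {i} (β i)) (F : Finset ℕ) {a : ℕ} (ha : 0 < a) :
    ∃ (I : Finset ℕ) (c : ℕ), Disjoint I F ∧ Odd c ∧ a.Coprime c ∧ RepresentsUpToSq b σ e I c := by
  -- The exponent 3 leaves a congruence modulo 4a after division by d², as d divides a.
  have : NeZero (4 * a ^ 3) := ⟨by positivity⟩
  have hinf : Infinite ↥(𝓘 \ (F : Set ℕ)) := (h𝓘.sdiff F.finite_toSet).to_subtype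
  obtain ⟨r, hr⟩ := Finite.exists_infinite_fiber
    (fun i : ↥(𝓘 \ (F : Set ℕ)) => ((β i : ℕ) : ZMod (4 * a ^ 3)))
  let g := Infinite.natEmbedding
    ↥((fun i : ↥(𝓘 \ (F : Set ℕ)) => ((β i : ℕ) : ZMod (4 * a ^ 3))) ⁻¹' {r})
  let i : ℕ → ℕ := fun k => ((g k : ↥(𝓘 \ (F : Set ℕ))) : ℕ)
  have hi : Function.Injective i := fun k l h => g.injective (Subtype.ext (Subtype.ext h))
  have hi𝓘 : ∀ k, i k ∈ 𝓘 := fun k => (g k).1.2.1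
  have hiF : ∀ k, i k ∉ F := fun k => (g k).1.2.2
  have hir : ∀ k, ((β (i k) : ℕ) : ZMod (4 * a ^ 3)) = r := fun k => (g k).2
  obtain ⟨d, hd⟩ : ∃ d, d = (β (i 0)).gcd a := ⟨_, rfl⟩
  have hd0 : 0 < d := hd ▸ Nat.gcd_pos_of_pos_right _ ha
  obtain ⟨β', hβ'⟩ : d ∣ β (i 0) := hd ▸ Nat.gcd_dvd_left _ _
  obtain ⟨a', ha'⟩ : d ∣ a := hd ▸ Nat.gcd_dvd_right _ _
  obtain ⟨x0, x1, x2, x3, hx⟩ := Nat.sum_four_squares d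
  obtain ⟨S, hS⟩ : ∃ S, S = β (i 0) * x0 ^ 2 + β (i 1) * x1 ^ 2 + β (i 2) * x2 ^ 2
    + β (i 3) * x3 ^ 2 := ⟨_, rfl⟩
  have ne : ∀ {k l}, k ≠ l → i k ≠ i l := fun h h' => h (hi h')
  have rep := (((hrep _ (hi𝓘 0)).combine symm orth (by simp [ne]) (hrep _ (hi𝓘 1)) one_ne_zero
    (x := x0) (y := x1) (mul_one _).symm).combine symm orth (by simp [ne]) (hrep _ (hi𝓘 2))
    one_ne_zero (x := 1) (y := x2) (mul_one _).symm).combine symm orth (by simp [ne])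
    (hrep _ (hi𝓘 3)) one_ne_zero (x := 1) (y := x3) (c := S)
    (by rw [hS]; push_cast; ring)
  have hmod : (S : ZMod (4 * a ^ 3)) = ((d ^ 2 * β' : ℕ) : ZMod (4 * a ^ 3)) := by
    have h1 : (d ^ 2 * β' : ℕ) = β (i 0) * (x0 ^ 2 + x1 ^ 2 + x2 ^ 2 + x3 ^ 2) := by
      rw [hx, hβ']; ring
    rw [hS, h1]
    push_cast
    rw [hir, hir, hir, hir]; ring
  have hdS : ((4 * a ^ 3 : ℕ) : ℤ) ∣ (S : ℤ) - (d ^ 2 * β' : ℕ) := by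
    rw [← ZMod.intCast_zmod_eq_zero_iff_dvd]
    push_cast
    push_cast at hmod
    rw [hmod, sub_self]
  obtain ⟨t, ht⟩ := hdS
  have hd2 : d ^ 2 ∣ S := by
    have h1 : ((d ^ 2 : ℕ) : ℤ) ∣ S := by
      refine ⟨β' + 4 * a * a' ^ 2 * t, ?_⟩
      have haZ : (a : ℤ) = d * a' := by exact_mod_cast ha'
      push_cast at ht ⊢
      have : (4 * (a : ℤ) ^ 3) = d ^ 2 * (4 * a * a' ^ 2) := by rw [haZ]; ring
      rw [this] at ht
      linear_combination ht
    exact_mod_cast h1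
  obtain ⟨c, hc⟩ := hd2
  have hoc : Odd c ∧ c.Coprime a := by
    refine exists_coprime_cofactor (t := t.natAbs) (hβ _ (hi𝓘 0)) hd hβ' ha' ha (hodd _ (hi𝓘 0)) ?_
    rw [hc] at ht
    push_cast at ht
    rcases Int.natAbs_eq t with h | h
    · left; rw [← h]; linear_combination ht
    · right; rw [h] at ht; linear_combination ht
  rw [hc] at rep
  push_cast at rep
  exact ⟨_, c, by simp [hiF], hoc.1, hoc.2.symm,
    RepresentsUpToSq.of_mul_sq (by exact_mod_cast hd0.ne') rep⟩

/-- Take β_i with a coprime odd c represented on further indices, then a second such pair on fresh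
indices; each pair has an entry ≡ 1 mod 4, so the four together represent a square. -/
theorem exists_representsUpToSq_one (symm : ∀ x y, b x y = b y x)
    (orth : ∀ i j, i ≠ j → b (e i) (e j) = 0) {𝓘 : Set ℕ} (h𝓘 : 𝓘.Infinite) {β : ℕ → ℕ}
    (hβ : ∀ i ∈ 𝓘, Squarefree (β i)) (h4 : ∀ i ∈ 𝓘, β i % 4 = 1)
    (hrep : ∀ i ∈ 𝓘, RepresentsUpToSq b σ e {i} (β i)) (F : Finset ℕ) :
    ∃ I : Finset ℕ, Disjoint I F ∧ RepresentsUpToSq b σ e I 1 := by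
  have hodd : ∀ i ∈ 𝓘, Odd (β i) := fun i hi => by
    have := h4 i hi; rw [Nat.odd_iff]; omega
  have hpos : ∀ i ∈ 𝓘, 0 < β i := fun i hi => (hodd i hi).pos
  have key : ∀ F : Finset ℕ, ∃ (i : ℕ) (J : Finset ℕ) (c : ℕ), i ∈ 𝓘 ∧ i ∉ F ∧ i ∉ J ∧
      Disjoint J F ∧ Odd c ∧ (β i).Coprime c ∧ RepresentsUpToSq b σ e J c := fun F => by
    obtain ⟨i, hi, hiF⟩ := h𝓘.exists_notMem_finset F
    obtain ⟨J, c, hJ, hc, hcop, hr⟩ := exists_coprime_represented symm orth h𝓘 hβ hodd hrep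
      (insert i F) (hpos i hi)
    rw [Finset.disjoint_insert_right] at hJ
    exact ⟨i, J, c, hi, hiF, hJ.1, hJ.2, hc, hcop, hr⟩
  obtain ⟨i, J, c, hi, hiF, hiJ, hJF, hc, hcop, hr⟩ := key F
  obtain ⟨i', J', c', hi', hiF', hiJ', hJF', hc', hcop', hr'⟩ := key (F ∪ insert i J)
  obtain ⟨q, q', x, y, z, x', y', z', u, v, w, hz, hz', hw, h1, h2, h3⟩ :=
    exists_sq_of_coprime_pairs hcop (h4 i hi) hc hcop' (h4 i' hi') hc'
  rw [Finset.disjoint_union_right] at hJF'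
  rw [Finset.mem_union, not_or] at hiF'
  have r1 := (hrep i hi).combine symm orth (by simpa using hiJ) hr hz h1
  have r2 := (hrep i' hi').combine symm orth (by simpa using hiJ') hr' hz' h2
  refine ⟨_, ?_, r1.combine symm orth ?_ r2 hw (c := 1) (x := u) (y := v) (by rw [h3]; ring)⟩
  · simp only [Finset.disjoint_union_left, Finset.disjoint_singleton_left]
    exact ⟨⟨hiF, hJF⟩, hiF'.1, hJF'.1⟩
  · rw [← Finset.insert_eq, Finset.disjoint_union_right, Finset.disjoint_singleton_right]
    exact ⟨hiF'.2, hJF'.2.symm⟩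

/-- After removing a common factor 2 if there is one, both numbers are odd and congruent mod 4, so
their product is ≡ 1 mod 4, and removing an odd square preserves this. -/
theorem exists_sq_mul_squarefree_mod_four {t t' : ℕ} (ht : Squarefree t) (ht' : Squarefree t')
    (h : t % 8 = t' % 8) :
    ∃ s β : ℕ, s ≠ 0 ∧ s ^ 2 * β = t * t' ∧ Squarefree β ∧ β % 4 = 1 := by
  have ht0 : t ≠ 0 := ht.ne_zero
  have ht0' : t' ≠ 0 := ht'.ne_zero
  have hsqmod : ∀ s β u : ℕ, u % 4 = 1 → s ^ 2 * β = u → β % 4 = 1 := fun s β u hu hs => by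
    have h1 : (s ^ 2 * β) % 4 = 1 := by rw [hs, hu]
    rw [Nat.mul_mod, Nat.pow_mod] at h1
    have h2 : s % 4 < 4 := Nat.mod_lt _ (by norm_num)
    have h3 : β % 4 < 4 := Nat.mod_lt _ (by norm_num)
    interval_cases s % 4 <;> interval_cases β % 4 <;> simp_all
  rcases Nat.even_or_odd t with he | ho
  · obtain ⟨u, hu⟩ := he
    obtain ⟨u', hu'⟩ : Even t' := by rw [Nat.even_iff]; omega
    have hnot4 : ∀ k, t ≠ 4 * k := fun k hk => by
      have := ht 2 ⟨k, by rw [hk]; ring⟩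
      simp at this
    have hnot4' : t % 4 ≠ 0 := fun h0 => hnot4 (t / 4) (by omega)
    obtain ⟨β, s, hs, hβ⟩ := Nat.sq_mul_squarefree (u * u')
    have hu4 : (u * u') % 4 = 1 := by
      have h1 : u % 4 = u' % 4 := by omega
      have h2 : u' % 4 = 1 ∨ u' % 4 = 3 := by omega
      rw [Nat.mul_mod, h1]
      rcases h2 with h2 | h2 <;> rw [h2]
    refine ⟨2 * s, β, ?_, ?_, hβ, hsqmod s β _ hu4 hs⟩
    · rintro h0
      have : s = 0 := by omega
      rw [this] at hs
      rw [← hs] at hu4; simp at hu4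
    · rw [hu, hu', mul_pow, mul_assoc, hs]; ring
  · obtain ⟨β, s, hs, hβ⟩ := Nat.sq_mul_squarefree (t * t')
    have hu4 : (t * t') % 4 = 1 := by
      rw [Nat.odd_iff] at ho
      have h1 : t % 4 = t' % 4 := by omega
      have h2 : t' % 4 = 1 ∨ t' % 4 = 3 := by omega
      rw [Nat.mul_mod, h1]
      rcases h2 with h2 | h2 <;> rw [h2]
    refine ⟨s, β, ?_, hs, hβ, hsqmod s β _ hu4 hs⟩
    rintro rfl
    rw [← hs] at hu4; simp at hu4

/-- A form with an infinite orthogonal sequence of vectors of positive norm contains arbitrarily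
long orthogonal sequences of vectors of equal norm. -/
theorem exists_orthogonal_equal_norm (symm : ∀ x y, b x y = b y x)
    (orth : ∀ i j, i ≠ j → b (e i) (e j) = 0) (pos : ∀ i, 0 < b (e i) (e i)) (m : ℕ) :
    ∃ (D : ℤ) (v : Fin m → M), 0 < D ∧ ∀ i j, b (v i) (v j) = if i = j then D else 0 := by
  choose t s hst ht using fun i => Nat.sq_mul_squarefree (b (e i) (e i)).toNat
  have hst' : ∀ i, b (e i) (e i) = (s i : ℤ) ^ 2 * t i := fun i => by
    rw [← Int.toNat_of_nonneg (pos i).le, ← hst i]; push_cast; ring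
  have hs0 : ∀ i, (s i : ℤ) ≠ 0 := fun i h => by
    have := pos i; rw [hst', h] at this; simp at this
  obtain ⟨r, hr⟩ := Finite.exists_infinite_fiber (fun i : ℕ => ((t i : ℕ) : ZMod 8))
  have h𝓘 : ((fun i : ℕ => ((t i : ℕ) : ZMod 8)) ⁻¹' {r}).Infinite := Set.infinite_coe_iff.1 hr
  obtain ⟨𝓘, h𝓘def⟩ : ∃ 𝓘, 𝓘 = (fun i : ℕ => ((t i : ℕ) : ZMod 8)) ⁻¹' {r} := ⟨_, rfl⟩
  rw [← h𝓘def] at h𝓘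
  obtain ⟨i0, hi0⟩ := h𝓘.nonempty
  have hmod : ∀ i ∈ 𝓘, t i0 % 8 = t i % 8 := fun i hi => by
    rw [h𝓘def] at hi hi0
    have h1 : ((t i0 : ℕ) : ZMod 8) = t i := (show _ = r from hi0).trans (show _ = r from hi).symm
    exact (ZMod.natCast_eq_natCast_iff _ _ _).1 h1
  have hex : ∀ i, ∃ s β : ℕ, i ∈ 𝓘 → s ≠ 0 ∧ s ^ 2 * β = t i0 * t i ∧ Squarefree β ∧ β % 4 = 1 :=
    fun i => by
      by_cases hi : i ∈ 𝓘
      · obtain ⟨s, β, h⟩ := exists_sq_mul_squarefree_mod_four (ht i0) (ht i) (hmod i hi)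
        exact ⟨s, β, fun _ => h⟩
      · exact ⟨0, 0, fun h => (hi h).elim⟩
  choose s' β hβ using hex
  obtain ⟨σ, hσ⟩ : ∃ σ : ℤ, σ = t i0 := ⟨_, rfl⟩
  have hσ0 : 0 < σ := by
    rw [hσ]; exact_mod_cast Nat.pos_of_ne_zero (ht i0).ne_zero
  have hrep : ∀ i ∈ 𝓘, RepresentsUpToSq b σ e {i} (β i) := fun i hi => by
    refine ⟨e i, Submodule.subset_span ⟨i, by simp, rfl⟩, s i * s' i,
      mul_ne_zero (hs0 i) (by exact_mod_cast (hβ i hi).1), ?_⟩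
    have h1 : (s' i : ℤ) ^ 2 * β i = t i0 * t i := by exact_mod_cast (hβ i hi).2.1
    rw [hst', hσ]
    linear_combination - (s i : ℤ) ^ 2 * h1
  have step := exists_representsUpToSq_one symm orth h𝓘 (fun i hi => (hβ i hi).2.2.1)
    (fun i hi => (hβ i hi).2.2.2) hrep
  -- Two things are added for the induction: the vectors use finitely many indices, so a new one can
  -- be found off them, and σD is a square, so the new and old vectors can be rescaled to equal
  -- norm.
  suffices H : ∃ (D S : ℤ) (I : Finset ℕ) (v : Fin m → M), S ≠ 0 ∧ σ * D = S ^ 2 ∧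
      (∀ i, v i ∈ Submodule.span ℤ (e '' I)) ∧
      ∀ i j, b (v i) (v j) = if i = j then D else 0 by
    obtain ⟨D, S, I, v, hS, hD, -, hv⟩ := H
    refine ⟨D, v, ?_, hv⟩
    have : 0 < σ * D := by rw [hD]; positivity
    exact pos_of_mul_pos_right this hσ0.le
  induction m with
  | zero => exact ⟨σ, σ, ∅, Fin.elim0, hσ0.ne', by ring, fun i => i.elim0, fun i => i.elim0⟩
  | succ m ih =>
    obtain ⟨D, S, I, v, hS, hD, hvI, hv⟩ := ih
    obtain ⟨J, hJ, w, hw, s, hs, hws⟩ := step I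
    rw [one_mul] at hws
    have hvw : ∀ i, b (v i) w = 0 := fun i => apply_eq_zero_of_disjoint orth hJ.symm (hvI i) hw
    have hwv : ∀ i, b w (v i) = 0 := fun i => by rw [symm, hvw]
    refine ⟨s ^ 2 * D, s * S, I ∪ J, Fin.cons (S • w) (fun i => s • v i), by simp [hs, hS],
      by linear_combination s ^ 2 * hD, ?_, ?_⟩
    · refine Fin.cases ?_ fun i => ?_
      · exact Submodule.smul_mem _ _ (Submodule.span_mono (Set.image_mono (by simp)) hw)
      · exact Submodule.smul_mem _ _ (Submodule.span_mono (Set.image_mono (by simp)) (hvI i))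
    · refine Fin.cases ?_ fun i => ?_
      · refine Fin.cases ?_ fun j => ?_
        · simp only [Fin.cons_zero, map_smul, LinearMap.smul_apply, smul_eq_mul, if_true]
          apply mul_left_cancel₀ hσ0.ne'
          linear_combination S ^ 2 * hws - s ^ 2 * hD
        · simp [hwv, (Fin.succ_ne_zero j).symm]
      · refine Fin.cases ?_ fun j => ?_
        · simp [hvw, Fin.succ_ne_zero]
        · simp only [Fin.cons_succ, map_smul, LinearMap.smul_apply, smul_eq_mul, hv,
            Fin.succ_inj]
          split_ifs <;> ring

end

/-! ### Gram matrices represented by a positive semidefinite integral form -/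

section
variable {M : Type*} [AddCommGroup M]

/-- The Gram matrix of the tuple `x` is also the Gram matrix of a tuple in the submodule `P`. -/
def GramRealized {n : ℕ} (b : LinearMap.BilinForm ℤ M) (P : Submodule ℤ M) (x : Fin n → M) : Prop :=
  ∃ x' : Fin n → M, (∀ i, x' i ∈ P) ∧ ∀ i j, b (x' i) (x' j) = b (x i) (x j)

theorem GramRealized.mono {n : ℕ} {b : LinearMap.BilinForm ℤ M} {P P' : Submodule ℤ M}
    (h : P ≤ P') {x : Fin n → M} (hx : GramRealized b P x) : GramRealized b P' x :=
  let ⟨x', h1, h2⟩ := hx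
  ⟨x', fun i => h (h1 i), h2⟩

/-- The Gram matrix of the tuple `x` is positive definite. -/
def GramPosDef {n : ℕ} (b : LinearMap.BilinForm ℤ M) (x : Fin n → M) : Prop :=
  ∀ c : Fin n → ℤ, c ≠ 0 →
    0 < b (Fintype.linearCombination ℤ x c) (Fintype.linearCombination ℤ x c)

/-- Cauchy–Schwarz for a semidefinite form: otherwise z minus a large multiple of y would have
negative norm. -/
theorem apply_eq_zero_of_self_eq_zero {b : LinearMap.BilinForm ℤ M}
    (symm : ∀ x y, b x y = b y x) (nonneg : ∀ x, 0 ≤ b x x) {y : M} (hy : b y y = 0) (z : M) :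
    b y z = 0 := by
  by_contra h
  have h1 := nonneg (z - ((b z z + 1) * b y z) • y)
  simp only [map_sub, map_smul, LinearMap.sub_apply, LinearMap.smul_apply, smul_eq_mul, hy,
    symm z y] at h1
  have h2 := nonneg z
  have h3 : 1 ≤ (b y z) ^ 2 := by
    have := pow_pos (abs_pos.2 h) 2
    rw [sq_abs] at this; omega
  nlinarith

/-- If some finite set of vectors has only isotropic vectors in its orthogonal complement, then all
Gram matrices are realized in one finitely generated submodule. -/
theorem exists_fg_gramRealized_of_finite {b : LinearMap.BilinForm ℤ M}
    (symm : ∀ x y, b x y = b y x) (nonneg : ∀ x, 0 ≤ b x x) {s : Finset M}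
    (hs : ∀ y, (∀ x ∈ s, b x y = 0) → b y y = 0) (n : ℕ) :
    ∃ P : Submodule ℤ M, P.FG ∧ ∀ x : Fin n → M, GramRealized b P x := by
  let φ : M →ₗ[ℤ] (s → ℤ) := LinearMap.pi fun x => b (x : M)
  -- The image of φ lies in ℤ^s, so it is free and φ has a section g. Each y differs from g(φ y) by
  -- a vector orthogonal to s, hence by a radical vector.
  obtain ⟨g, hg⟩ := Module.projective_lifting_property φ.rangeRestrict LinearMap.id
    φ.surjective_rangeRestrict
  refine ⟨LinearMap.range g, Module.Finite.iff_fg.1 (Module.Finite.range g), fun x =>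
    ⟨fun i => g (φ.rangeRestrict (x i)), fun i => ⟨_, rfl⟩, ?_⟩⟩
  have hrad : ∀ y z, b (g (φ.rangeRestrict y)) z = b y z := fun y z => by
    rw [← sub_eq_zero, ← LinearMap.sub_apply, ← map_sub]
    refine apply_eq_zero_of_self_eq_zero symm nonneg (hs _ fun u hu => ?_) z
    have h1 : φ.rangeRestrict (g (φ.rangeRestrict y)) = φ.rangeRestrict y :=
      LinearMap.congr_fun hg _
    have h2 := congrFun (congrArg Subtype.val h1) ⟨u, hu⟩
    rw [map_sub, sub_eq_zero]
    exact h2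
  intro i j
  rw [hrad, symm, hrad, symm]

theorem apply_sum_sum_of_orthogonal {b : LinearMap.BilinForm ℤ M} {κ ι : Type*} [Fintype ι]
    [DecidableEq κ] [DecidableEq ι] {v : κ × ι → M} {D : ℤ}
    (hv : ∀ i j, b (v i) (v j) = if i = j then D else 0) (k k' : κ) (z z' : ι → ℤ) :
    b (∑ p, z p • v (k, p)) (∑ p, z' p • v (k', p))
      = if k = k' then D * (z ⬝ᵥ z') else 0 := by
  simp only [map_sum, LinearMap.sum_apply, map_smul, LinearMap.smul_apply, smul_eq_mul, hv,
    Prod.mk.injEq]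
  split_ifs with h
  · simp [h, dotProduct, Finset.mul_sum]
    exact Finset.sum_congr rfl fun i _ => by ring
  · simp [h]

/-- In a sufficiently large orthogonal system of vectors of norm `D` one finds, orthogonally to
given vectors `x i`, an orthogonal family whose norms are prescribed multiples of `2 * D` that are
zero or large. -/
theorem exists_orthogonal_family {b : LinearMap.BilinForm ℤ M} {n h : ℕ} (hn : 2 * n < h) {Λ : Type*} [Fintype Λ] [DecidableEq Λ] {D : ℤ}
    {v : (Λ × Fin 2) × (Fin h × Fin 4) → M}
    (hv : ∀ i j, b (v i) (v j) = if i = j then D else 0) (x : Fin n → M) :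
    ∃ T : ℕ, ∀ k : Λ → ℕ, (∀ l, k l = 0 ∨ T ≤ k l) → ∃ w : Λ → M,
      (∀ l, w l ∈ Submodule.span ℤ (Set.range v)) ∧ (∀ l i, b (w l) (x i) = 0) ∧
      ∀ l l', b (w l) (w l') = if l = l' then 2 * D * k l else 0 := by
  choose T hT using fun l : Λ => exists_orthogonal_pair_norm hn
    (fun i p => b (v ((l, 0), p)) (x i)) (fun i p => b (v ((l, 1), p)) (x i))
  refine ⟨Finset.univ.sup T, fun k hk => ?_⟩
  have hex : ∀ l, ∃ z z' : Fin h × Fin 4 → ℤ,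
      (∀ i, z ⬝ᵥ (fun p => b (v ((l, 0), p)) (x i)) = 0) ∧
      (∀ i, z' ⬝ᵥ (fun p => b (v ((l, 1), p)) (x i)) = 0) ∧ z ⬝ᵥ z + z' ⬝ᵥ z' = 2 * k l := by
    intro l
    rcases hk l with h0 | h0
    · exact ⟨0, 0, by simp, by simp, by simp [h0]⟩
    · exact hT l (k l) ((Finset.le_sup (Finset.mem_univ l)).trans h0)
  choose z z' hz hz' hzz using hex
  refine ⟨fun l => ∑ p, z l p • v ((l, 0), p) + ∑ p, z' l p • v ((l, 1), p), fun l => ?_,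
    fun l i => ?_, fun l l' => ?_⟩
  · exact Submodule.add_mem _
      (Submodule.sum_mem _ fun p _ => Submodule.smul_mem _ _ (Submodule.subset_span ⟨_, rfl⟩))
      (Submodule.sum_mem _ fun p _ => Submodule.smul_mem _ _ (Submodule.subset_span ⟨_, rfl⟩))
  · have h1 := hz l i
    have h2 := hz' l i
    simp only [dotProduct] at h1 h2
    simp only [map_add, map_sum, LinearMap.add_apply, LinearMap.sum_apply, map_smul,
      LinearMap.smul_apply, smul_eq_mul, h1, h2, add_zero]
  · simp only [map_add, LinearMap.add_apply, apply_sum_sum_of_orthogonal hv, Prod.mk.injEq]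
    by_cases h : l = l'
    · subst h
      have := hzz l
      simp
      linear_combination D * this
    · simp [h]

theorem Ultrafilter.eventually_eq_const_of_abs_le {ι : Type*} (U : Ultrafilter ι) {g : ι → ℤ}
    {C : ℤ} (hg : ∀ᶠ j in (U : Filter ι), |g j| ≤ C) : ∃ r, ∀ᶠ j in (U : Filter ι), g j = r := by
  have h1 : Set.Icc (-C) C ∈ U.map g := by
    rw [Ultrafilter.mem_map]
    filter_upwards [hg] with j hj using abs_le.1 hj
  obtain ⟨r, -, hr⟩ := Ultrafilter.eq_pure_of_finite_mem (Set.finite_Icc (-C) C) h1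
  refine ⟨r, ?_⟩
  have h2 : ({r} : Set ℤ) ∈ U.map g := by rw [hr]; exact Ultrafilter.mem_pure.2 rfl
  exact Ultrafilter.mem_map.1 h2

/-- The Gram matrix of `x` is a nonnegative combination of squares of linear forms with
coefficients bounded by `T`. -/
def GramReduced {n : ℕ} (b : LinearMap.BilinForm ℤ M) (T : ℤ) (x : Fin n → M) : Prop :=
  ∃ c : (Fin n → Finset.Icc (-T) T) → NNReal,
    ∀ i j, (b (x i) (x j) : ℝ) = ∑ l, (c l : ℝ) * ((l i : ℤ) * (l j : ℤ))

/-- Apply the reduction theorem to the form pulled back to ℤⁿ; the inverse change of basis carries a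
realization of the reduced tuple to one of x. -/
theorem exists_gramReduced (n : ℕ) : ∃ T : ℤ, ∀ (b : LinearMap.BilinForm ℤ M),
    (∀ x y, b x y = b y x) → ∀ x : Fin n → M, GramPosDef b x → ∃ x' : Fin n → M,
      GramReduced b T x' ∧ ∀ P, GramRealized b P x' → GramRealized b P x := by
  obtain ⟨T, hT⟩ := exists_basis_gram_eq_sum n
  refine ⟨T, fun b symm x hx => ?_⟩
  let φ := Fintype.linearCombination ℤ x
  let β : LinearMap.BilinForm ℤ (Fin n → ℤ) := b.comp φ φ
  obtain ⟨e, c, hc⟩ := hT (Fin n → ℤ) β (by simp) (fun u w => symm _ _) (fun u hu => hx u hu)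
  refine ⟨fun a => φ (e a), ⟨c, hc⟩, ?_⟩
  rintro P ⟨y, hyP, hy⟩
  let ψ := e.constr ℤ y
  have hψ : b.comp ψ ψ = β := by
    refine LinearMap.BilinForm.ext_basis e fun i j => ?_
    simp only [LinearMap.BilinForm.comp_apply, ψ, Module.Basis.constr_basis, hy, β]
  refine ⟨fun i => ψ (Pi.single i 1), fun i => ?_, fun i j => ?_⟩
  · simp only [ψ, Module.Basis.constr_apply_fintype]
    exact Submodule.sum_mem _ fun k _ => Submodule.smul_mem _ _ (hyP k)
  · have h1 := LinearMap.congr_fun₂ hψ (Pi.single i 1) (Pi.single j 1)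
    simpa [β, φ, Fintype.linearCombination_apply_single] using h1

/-- Dickson-type lemma for sequences of reduced Gram matrices. -/
theorem exists_lt_gram_eq_add {n : ℕ} {b : LinearMap.BilinForm ℤ M} {T : ℤ} {E : ℤ} (hE : 0 < E)
    {f : ℕ → Fin n → M} (hf : ∀ j, GramReduced b T (f j)) (N : ℕ → ℕ) :
    ∃ (i j : ℕ) (k : (Fin n → Finset.Icc (-T) T) → ℕ), i < j ∧ (∀ l, k l = 0 ∨ N i ≤ k l) ∧
      ∀ a a', b (f j a) (f j a') = b (f i a) (f i a')
        + ∑ l, E * k l * ((l a : ℤ) * (l a' : ℤ)) := by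
  choose c hc using hf
  have hE' : (0 : ℝ) < E := by exact_mod_cast hE
  -- Integer parts of the cone coefficients in units of E. The remainder R is a bounded integral
  -- matrix, so it is constant along a nonprincipal ultrafilter.
  let k : ℕ → (Fin n → Finset.Icc (-T) T) → ℕ := fun j l => ⌊(c j l : ℝ) / E⌋₊
  let R : ℕ → Fin n → Fin n → ℤ := fun j a a' =>
    b (f j a) (f j a') - ∑ l, E * k j l * ((l a : ℤ) * (l a' : ℤ))
  let U : Ultrafilter ℕ := Filter.hyperfilter ℕ
  have hθ : ∀ j l, |(c j l : ℝ) - E * k j l| ≤ E := fun j l => by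
    have h1 : ((k j l : ℕ) : ℝ) ≤ (c j l : ℝ) / E := Nat.floor_le (by positivity)
    have h2 : (c j l : ℝ) / E < (k j l : ℕ) + 1 := Nat.lt_floor_add_one _
    rw [le_div_iff₀ hE'] at h1
    rw [div_lt_iff₀ hE'] at h2
    rw [abs_le]; constructor <;> nlinarith
  have hl : ∀ (l : Fin n → Finset.Icc (-T) T) a, |((l a : ℤ) : ℝ)| ≤ T := fun l a => by
    have := abs_le.2 (Finset.mem_Icc.1 (l a).2)
    exact_mod_cast this
  have hR : ∀ a a', ∃ r, ∀ᶠ j in (U : Filter ℕ), R j a a' = r := fun a a' => by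
    refine U.eventually_eq_const_of_abs_le
      (C := Fintype.card (Fin n → Finset.Icc (-T) T) * (E * (T * T)))
      (Filter.Eventually.of_forall fun j => ?_)
    have h1 : (R j a a' : ℝ) = ∑ l, ((c j l : ℝ) - E * k j l) * ((l a : ℤ) * (l a' : ℤ)) := by
      simp only [R]
      push_cast
      rw [hc, ← Finset.sum_sub_distrib]
      exact Finset.sum_congr rfl fun l _ => by ring
    have h2 : |(R j a a' : ℝ)| ≤ Fintype.card (Fin n → Finset.Icc (-T) T) * (E * (T * T)) := by
      rw [h1]
      refine (Finset.abs_sum_le_sum_abs _ _).trans ?_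
      have : ∀ l ∈ (Finset.univ : Finset (Fin n → Finset.Icc (-T) T)),
          |((c j l : ℝ) - E * k j l) * ((l a : ℤ) * (l a' : ℤ))| ≤ (E * (T * T) : ℝ) := by
        intro l _
        rw [abs_mul, abs_mul]
        have h3 := hl l a
        have h4 := hl l a'
        exact mul_le_mul (hθ j l) (mul_le_mul h3 h4 (abs_nonneg _) ((abs_nonneg _).trans h3))
          (by positivity) hE'.le
      refine (Finset.sum_le_sum this).trans ?_
      rw [Finset.sum_const, nsmul_eq_mul, Finset.card_univ]
    exact_mod_cast h2
  choose r hr using hR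
  -- Along the ultrafilter each integer part is constant or tends to infinity, so for fixed i a
  -- later j has every difference zero or at least `N i`.
  have hk : ∀ l, (∃ κ, ∀ᶠ j in (U : Filter ℕ), k j l = κ) ∨
      ∀ K, ∀ᶠ j in (U : Filter ℕ), K ≤ k j l := fun l => by
    by_contra! hcon
    obtain ⟨h1, K, hK⟩ := hcon
    have hK' : ∀ᶠ j in (U : Filter ℕ), |((k j l : ℕ) : ℤ)| ≤ K := by
      filter_upwards [Ultrafilter.frequently_iff_eventually.1 (by simpa using hK)] with j hj
      rw [Nat.abs_cast]; exact_mod_cast hj.le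
    obtain ⟨κ, hκ⟩ := U.eventually_eq_const_of_abs_le hK'
    obtain ⟨j, hj, hj'⟩ := (hκ.and (h1 κ.toNat)).exists
    omega
  have hall : ∀ᶠ j in (U : Filter ℕ), (∀ a a', R j a a' = r a a') ∧
      ∀ l κ, (∀ᶠ j in (U : Filter ℕ), k j l = κ) → k j l = κ := by
    refine Filter.Eventually.and ?_ ?_
    · simp only [Filter.eventually_all]
      exact hr
    · rw [Filter.eventually_all]
      intro l
      by_cases h : ∃ κ, ∀ᶠ j in (U : Filter ℕ), k j l = κ
      · obtain ⟨κ, hκ⟩ := h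
        filter_upwards [hκ] with j hj κ' hκ'
        obtain ⟨j', h1, h2⟩ := (hκ.and hκ').exists
        rw [hj, ← h1, h2]
      · exact Filter.Eventually.of_forall fun j κ hκ => (h ⟨κ, hκ⟩).elim
  obtain ⟨i, hiR, hik⟩ := hall.exists
  have hlarge : ∀ᶠ j in (U : Filter ℕ), ∀ l,
      (∀ K, ∀ᶠ j in (U : Filter ℕ), K ≤ k j l) → k i l + N i ≤ k j l := by
    rw [Filter.eventually_all]
    intro l
    by_cases h : ∀ K, ∀ᶠ j in (U : Filter ℕ), K ≤ k j l
    · filter_upwards [h (k i l + N i)] with j hj _ using hj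
    · exact Filter.Eventually.of_forall fun j h' => (h h').elim
  have hgt : ∀ᶠ j in (U : Filter ℕ), i < j :=
    (Nat.hyperfilter_le_atTop : (U : Filter ℕ) ≤ Filter.atTop) (Filter.eventually_gt_atTop i)
  obtain ⟨j, ⟨⟨hjR, hjk⟩, hjl⟩, hij⟩ := ((hall.and hlarge).and hgt).exists
  have hcases : ∀ l, k j l = k i l ∨ k i l + N i ≤ k j l := fun l => by
    rcases hk l with ⟨κ, hκ⟩ | h
    · left; rw [hjk l κ hκ, hik l κ hκ]
    · right; exact hjl l h
  refine ⟨i, j, fun l => k j l - k i l, hij, fun l => by have := hcases l; dsimp only; omega,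
    fun a a' => ?_⟩
  have h1 : R j a a' = R i a a' := by rw [hjR, hiR]
  have h2 : ∀ l, ((k j l - k i l : ℕ) : ℤ) = k j l - k i l := fun l => by
    have := hcases l; omega
  simp only [h2, mul_sub, sub_mul, Finset.sum_sub_distrib]
  simp only [R] at h1
  linarith

/-- For a positive semidefinite integral form, all positive definite Gram matrices of a given size
are realized in one finitely generated submodule. -/
theorem exists_fg_gramRealized {b : LinearMap.BilinForm ℤ M} (symm : ∀ x y, b x y = b y x)
    (nonneg : ∀ x, 0 ≤ b x x) (n : ℕ) :
    ∃ P : Submodule ℤ M, P.FG ∧ ∀ x : Fin n → M, GramPosDef b x → GramRealized b P x := by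
  classical
  by_cases H : ∀ s : Finset M, (∀ x ∈ s, 0 < b x x) → ∃ y, 0 < b y y ∧ ∀ x ∈ s, b x y = 0
  swap
  · push Not at H
    obtain ⟨s, -, hs⟩ := H
    obtain ⟨P, hP, hPx⟩ := exists_fg_gramRealized_of_finite symm nonneg (s := s)
      (fun y hy => by
        by_contra h0
        obtain ⟨x, hx, hxy⟩ := hs y (lt_of_le_of_ne (nonneg y) (Ne.symm h0))
        exact hxy (hy x hx)) n
    exact ⟨P, hP, fun x _ => hPx x⟩
  obtain ⟨e, epos, eorth⟩ := exists_seq_of_forall_finset_exists _ _ H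
  have eorth' : ∀ i j, i ≠ j → b (e i) (e j) = 0 := fun i j hij => by
    rcases lt_or_gt_of_ne hij with h | h
    · exact eorth i j h
    · rw [symm]; exact eorth j i h
  obtain ⟨T, hT⟩ := exists_gramReduced (M := M) n
  -- For each linear form, two blocks of h quadruples, with h = 2n + 1 the least value exceeding 2n.
  let κ := ((Fin n → Finset.Icc (-T) T) × Fin 2) × (Fin (2 * n + 1) × Fin 4)
  obtain ⟨D, v', hD, hv'⟩ := exists_orthogonal_equal_norm symm eorth' epos (Fintype.card κ)
  let v : κ → M := fun p => v' (Fintype.equivFin κ p)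
  have hv : ∀ p q, b (v p) (v q) = if p = q then D else 0 := fun p q => by
    simp only [v, hv', EmbeddingLike.apply_eq_iff_eq]
  let F : Submodule ℤ M := Submodule.span ℤ (Set.range v)
  have hF : F.FG := Submodule.fg_span (Set.finite_range v)
  by_contra! hcon
  -- A sequence of reduced tuples, none realized in F plus the span of any single earlier one.
  obtain ⟨f, hf, hbad⟩ := exists_seq_of_forall_finset_exists (α := Fin n → M) (GramReduced b T)
    (fun x y => ¬ GramRealized b (F ⊔ Submodule.span ℤ (Set.range x)) y) (fun s _ => by
      obtain ⟨x, hx, hxP⟩ := hcon (F ⊔ ⨆ x ∈ s, Submodule.span ℤ (Set.range x))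
        (hF.sup (Submodule.fg_biSup s _ fun x _ => Submodule.fg_span (Set.finite_range x)))
      obtain ⟨x', hx', hxx'⟩ := hT b symm x hx
      refine ⟨x', hx', fun y hy h => hxP (hxx' _ (h.mono ?_))⟩
      exact sup_le_sup_left (le_biSup (fun x : Fin n → M => Submodule.span ℤ (Set.range x)) hy) _)
  choose N hN using fun i => exists_orthogonal_family (Nat.lt_succ_self (2 * n)) hv (f i)
  obtain ⟨i, j, k, hij, hk, hgram⟩ := exists_lt_gram_eq_add (E := 2 * D) (by omega) hf N
  obtain ⟨w, hwF, hwx, hww⟩ := hN i k hk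
  refine hbad i j hij ⟨fun a => f i a + ∑ l, (l a : ℤ) • w l, fun a => ?_, fun a a' => ?_⟩
  · exact Submodule.add_mem _ (Submodule.mem_sup_right (Submodule.subset_span ⟨a, rfl⟩))
      (Submodule.mem_sup_left (Submodule.sum_mem _ fun l _ => Submodule.smul_mem _ _ (hwF l)))
  · have hxw : ∀ l a, b (f i a) (w l) = 0 := fun l a => by rw [symm, hwx]
    rw [hgram]
    simp only [map_add, map_sum, LinearMap.add_apply, LinearMap.sum_apply, map_smul,
      LinearMap.smul_apply, smul_eq_mul, hxw, hwx, hww, mul_zero, Finset.sum_const_zero, add_zero,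
      zero_add, mul_ite, Finset.sum_ite_eq', Finset.mem_univ, if_true]
    congr 1
    exact Finset.sum_congr rfl fun l _ => by ring

end

/-! ### Integral lattices and finiteness of universality criteria -/

instance QLattice.instModuleFinite (M : QLattice) : Module.Finite ℤ M.L :=
  Module.Finite.iff_fg.2 M.fg

instance QLattice.instModuleFree (M : QLattice) : Module.Free ℤ M.L :=
  haveI : Module.IsTorsionFree ℤ M.V := Module.IsTorsionFree.trans_faithfulSMul ℤ ℚ M.V
  inferInstance

namespace IntegralLattice

theorem exists_intForm (M : IntegralLattice) :
    ∃ β : LinearMap.BilinForm ℤ M.1.L, ∀ x y : M.1.L, (β x y : ℚ) = M.1.B x y := by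
  have h : ∀ x y : M.1.L, ∃ m : ℤ, (m : ℚ) = M.1.B x y := fun x y => by
    obtain ⟨m, hm⟩ := M.2 (Submodule.subset_span ⟨x, x.2, y, y.2, rfl⟩ : M.1.B x y ∈ M.1.scale)
    exact ⟨m, hm⟩
  choose m hm using h
  refine ⟨LinearMap.mk₂ ℤ m (fun x x' y => ?_) (fun c x y => ?_) (fun x y y' => ?_)
    (fun c x y => ?_), fun x y => hm x y⟩
  all_goals
    apply Int.cast_injective (α := ℚ)
    simp [hm, ← Int.cast_smul_eq_zsmul ℚ]

/-- The bilinear form of an integral lattice, with values in `ℤ`. -/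
noncomputable def intForm (M : IntegralLattice) : LinearMap.BilinForm ℤ M.1.L :=
  (exists_intForm M).choose

theorem intForm_cast (M : IntegralLattice) (x y : M.1.L) : (M.intForm x y : ℚ) = M.1.B x y :=
  (exists_intForm M).choose_spec x y

theorem intForm_self_cast (M : IntegralLattice) (x : M.1.L) : (M.intForm x x : ℚ) = M.1.form x := by
  rw [intForm_cast, QLattice.B, QuadraticMap.associated_eq_self_apply, QLattice.form_apply]

theorem intForm_symm (M : IntegralLattice) (x y : M.1.L) : M.intForm x y = M.intForm y x := by
  apply Int.cast_injective (α := ℚ)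
  rw [intForm_cast, intForm_cast, QLattice.B]
  exact QuadraticMap.associated_isSymm ℚ M.1.Q _ _

theorem intForm_pos (M : IntegralLattice) {x : M.1.L} (hx : x ≠ 0) : 0 < M.intForm x x := by
  have : (0 : ℚ) < M.intForm x x := by
    rw [intForm_self_cast, QLattice.form_apply]
    exact M.1.posDef x (by simpa using hx)
  exact_mod_cast this

theorem intForm_nonneg (M : IntegralLattice) (x : M.1.L) : 0 ≤ M.intForm x x := by
  by_cases hx : x = 0
  · simp [hx]
  · exact (M.intForm_pos hx).le

theorem apply_linearCombination_eq {A A' : Type*} [AddCommGroup A] [AddCommGroup A'] {ι : Type*}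
    [Fintype ι] {b : LinearMap.BilinForm ℤ A} {b' : LinearMap.BilinForm ℤ A'} {x : ι → A}
    {x' : ι → A'} (h : ∀ i j, b (x i) (x j) = b' (x' i) (x' j)) (c d : ι → ℤ) :
    b (Fintype.linearCombination ℤ x c) (Fintype.linearCombination ℤ x d)
      = b' (Fintype.linearCombination ℤ x' c) (Fintype.linearCombination ℤ x' d) := by
  simp only [Fintype.linearCombination_apply, map_sum, LinearMap.sum_apply, map_smul,
    LinearMap.smul_apply, h]

theorem represents_of_gram {M K : IntegralLattice} {ι : Type*} [Fintype ι]
    (e : Module.Basis ι ℤ K.1.L) {x : ι → M.1.L}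
    (hx : ∀ i j, M.intForm (x i) (x j) = K.intForm (e i) (e j)) : M.1.Represents K.1 := by
  refine ⟨⟨(Fintype.linearCombination ℤ x).comp e.equivFun.toLinearMap, fun y => ?_⟩⟩
  change M.1.form (Fintype.linearCombination ℤ x (e.equivFun y)) = K.1.form y
  rw [← intForm_self_cast, ← intForm_self_cast, apply_linearCombination_eq hx]
  have : Fintype.linearCombination ℤ e (e.equivFun y) = y := by
    rw [Fintype.linearCombination_apply]; exact e.sum_equivFun y
  rw [this]

theorem apply_eq_of_apply_self_eq {A A' : Type*} [AddCommGroup A] [AddCommGroup A']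
    {b : LinearMap.BilinForm ℤ A} {b' : LinearMap.BilinForm ℤ A'} (symm : ∀ x y, b x y = b y x)
    (symm' : ∀ x y, b' x y = b' y x) {f : A →ₗ[ℤ] A'} (h : ∀ x, b' (f x) (f x) = b x x) (x y : A) :
    b' (f x) (f y) = b x y := by
  have h1 := h (x + y)
  simp only [map_add, LinearMap.add_apply, h, symm y x, symm' (f y) (f x)] at h1
  omega

theorem exists_map_of_represents {M K : IntegralLattice} (h : M.1.Represents K.1) :
    ∃ f : K.1.L →ₗ[ℤ] M.1.L, ∀ x y, M.intForm (f x) (f y) = K.intForm x y := by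
  obtain ⟨σ⟩ := h
  refine ⟨σ.toLinearMap, apply_eq_of_apply_self_eq K.intForm_symm M.intForm_symm fun x => ?_⟩
  apply Int.cast_injective (α := ℚ)
  rw [intForm_self_cast, intForm_self_cast]
  exact σ.map_app x

theorem rank_le_of_represents {M K : IntegralLattice} (h : M.1.Represents K.1) :
    K.1.rank ≤ M.1.rank := by
  obtain ⟨f, hf⟩ := exists_map_of_represents h
  refine LinearMap.finrank_le_finrank_of_injective (f := f) ?_
  rw [← LinearMap.ker_eq_bot, LinearMap.ker_eq_bot']
  intro x hx
  by_contra h0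
  have := K.intForm_pos h0
  rw [← hf, hx] at this
  simp at this

/-! ### Ultralimits of integral forms and the finiteness theorem. -/

theorem exists_limit_form {A : Type*} [AddCommGroup A] {ι : Type*} (U : Ultrafilter ι)
    (b : ι → LinearMap.BilinForm ℤ A)
    (h : ∀ u v, ∃ t, ∀ᶠ j in (U : Filter ι), b j u v = t) :
    ∃ B : LinearMap.BilinForm ℤ A, ∀ u v, ∀ᶠ j in (U : Filter ι), b j u v = B u v := by
  choose f hf using h
  have uniq : ∀ {u v t}, (∀ᶠ j in (U : Filter ι), b j u v = t) → f u v = t := fun {u v t} ht => by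
    obtain ⟨j, h1, h2⟩ := ((hf u v).and ht).exists
    rw [← h1, h2]
  refine ⟨LinearMap.mk₂ ℤ f (fun u u' v => uniq ?_) (fun c u v => uniq ?_) (fun u v v' => uniq ?_)
    (fun c u v => uniq ?_), fun u v => hf u v⟩
  · filter_upwards [hf u v, hf u' v] with j h1 h2
    simp [h1, h2]
  · filter_upwards [hf u v] with j h1
    simp [h1]
  · filter_upwards [hf u v, hf u v'] with j h1 h2
    simp [h1, h2]
  · filter_upwards [hf u v] with j h1
    simp [h1]

theorem exists_eventually_eq_of_single {κ : Type*} {ι : Type*} (U : Ultrafilter ι)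
    (b : ι → LinearMap.BilinForm ℤ (κ →₀ ℤ))
    (h : ∀ p q, ∃ t, ∀ᶠ j in (U : Filter ι),
      b j (Finsupp.single p 1) (Finsupp.single q 1) = t) (u v : κ →₀ ℤ) :
    ∃ t, ∀ᶠ j in (U : Filter ι), b j u v = t := by
  induction u using Finsupp.induction_linear with
  | zero => exact ⟨0, by simp⟩
  | add u u' h1 h2 =>
    obtain ⟨t, ht⟩ := h1
    obtain ⟨t', ht'⟩ := h2
    refine ⟨t + t', ?_⟩
    filter_upwards [ht, ht'] with j h1 h2
    simp [h1, h2]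
  | single p c =>
    induction v using Finsupp.induction_linear with
    | zero => exact ⟨0, by simp⟩
    | add u u' h1 h2 =>
      obtain ⟨t, ht⟩ := h1
      obtain ⟨t', ht'⟩ := h2
      refine ⟨t + t', ?_⟩
      filter_upwards [ht, ht'] with j h1 h2
      simp [h1, h2]
    | single q d =>
      obtain ⟨t, ht⟩ := h p q
      refine ⟨c * d * t, ?_⟩
      filter_upwards [ht] with j h1
      rw [← mul_one c, ← mul_one d, ← smul_eq_mul, ← smul_eq_mul, ← Finsupp.smul_single,
        ← Finsupp.smul_single, map_smul, map_smul, LinearMap.smul_apply, h1]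
      simp only [smul_eq_mul]
      ring

theorem two_mul_abs_apply_le {A : Type*} [AddCommGroup A] {b : LinearMap.BilinForm ℤ A}
    (symm : ∀ x y, b x y = b y x) (nonneg : ∀ x, 0 ≤ b x x) (x y : A) :
    2 * |b x y| ≤ b x x + b y y := by
  have h1 := nonneg (x + y)
  have h2 := nonneg (x - y)
  simp only [map_add, map_sub, LinearMap.add_apply, LinearMap.sub_apply, symm y x] at h1 h2
  rcases abs_cases (b x y) with ⟨h, -⟩ | ⟨h, -⟩ <;> rw [h] <;> omega

/-- Every set of classes of lattices of rank `n` has a finite subset such that all integral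
lattices representing the subset represent the whole set. -/
theorem exists_finite_universality_criterion {n : ℕ} {S : Set LatticeClass} (hS : S ⊆ Phi n) :
    ∃ X ⊆ S, X.Finite ∧ ∀ M : IntegralLattice, IsUniversal X M → IsUniversal S M := by
  classical
  by_contra! hcon
  choose K hKrank hKcls using fun c : S => hS c.2
  let κ : ∀ c : S, Module.Basis (Fin n) ℤ (K c).1.L := fun c =>
    Module.finBasisOfFinrankEq ℤ _ (hKrank c)
  have hex : ∀ X : Finset S, ∃ L : IntegralLattice, IsUniversal (Subtype.val '' (X : Set S)) L ∧
      ¬ IsUniversal S L := fun X =>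
    hcon _ (Subtype.coe_image_subset _ _) (X.finite_toSet.image _)
  choose L hLX hLS using hex
  -- The default value 0 off X bounds the norms uniformly in X, so every Gram entry has an
  -- ultralimit.
  have hx : ∀ (X : Finset S) (c : S), ∃ x : Fin n → (L X).1.L,
      (c ∈ X → ∀ i j, (L X).intForm (x i) (x j) = (K c).intForm (κ c i) (κ c j)) ∧
      (c ∉ X → x = 0) := fun X c => by
    by_cases hc : c ∈ X
    · have h1 := hLX X c ⟨c, hc, rfl⟩
      rw [← hKcls c, representsClass_cls] at h1
      obtain ⟨f, hf⟩ := exists_map_of_represents h1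
      exact ⟨fun i => f (κ c i), fun _ i j => hf _ _, fun h => (h hc).elim⟩
    · exact ⟨0, fun h => (hc h).elim, fun _ => rfl⟩
  choose x hxmem hxnot using hx
  have hbound : ∀ X c i, (L X).intForm (x X c i) (x X c i) ≤ (K c).intForm (κ c i) (κ c i) := by
    intro X c i
    by_cases hc : c ∈ X
    · rw [hxmem X c hc]
    · rw [hxnot X c hc]; simpa using (K c).intForm_nonneg _
  let φ : ∀ X : Finset S, ((S × Fin n) →₀ ℤ) →ₗ[ℤ] (L X).1.L := fun X =>
    Finsupp.linearCombination ℤ fun p : S × Fin n => x X p.1 p.2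
  let bX : Finset S → LinearMap.BilinForm ℤ ((S × Fin n) →₀ ℤ) := fun X =>
    (L X).intForm.comp (φ X) (φ X)
  have hbX : ∀ X u v, bX X u v = (L X).intForm (φ X u) (φ X v) := fun X u v => rfl
  have hφ : ∀ X p, φ X (Finsupp.single p 1) = x X p.1 p.2 := fun X p => by simp [φ]
  -- Refining `atTop` ensures that each class lies in almost all X, so its Gram matrix survives in
  -- the limit.
  let U : Ultrafilter (Finset S) := Ultrafilter.of Filter.atTop
  have hU : (U : Filter (Finset S)) ≤ Filter.atTop := Ultrafilter.of_le _
  obtain ⟨b, hb⟩ := exists_limit_form U bX (exists_eventually_eq_of_single U bX fun p q => by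
    refine U.eventually_eq_const_of_abs_le
      (C := (K p.1).intForm (κ p.1 p.2) (κ p.1 p.2) + (K q.1).intForm (κ q.1 q.2) (κ q.1 q.2))
      (Filter.Eventually.of_forall fun X => ?_)
    rw [hbX, hφ, hφ]
    have h1 := two_mul_abs_apply_le (L X).intForm_symm (L X).intForm_nonneg
      (x X p.1 p.2) (x X q.1 q.2)
    have h2 := hbound X p.1 p.2
    have h3 := hbound X q.1 q.2
    have h4 := abs_nonneg ((L X).intForm (x X p.1 p.2) (x X q.1 q.2))
    omega)
  have symm : ∀ u v, b u v = b v u := fun u v => by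
    obtain ⟨X, h1, h2⟩ := ((hb u v).and (hb v u)).exists
    rw [← h1, ← h2, hbX, hbX, intForm_symm]
  have nonneg : ∀ u, 0 ≤ b u u := fun u => by
    obtain ⟨X, h1⟩ := (hb u u).exists
    rw [← h1, hbX]
    exact intForm_nonneg _ _
  let y : S → Fin n → ((S × Fin n) →₀ ℤ) := fun c i => Finsupp.single (c, i) 1
  have hgram : ∀ c i j, b (y c i) (y c j) = (K c).intForm (κ c i) (κ c j) := fun c i j => by
    obtain ⟨X, h1, h2⟩ := ((hb (y c i) (y c j)).and
      (hU (Filter.eventually_ge_atTop ({c} : Finset S)))).exists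
    have hc : c ∈ X := h2 (Finset.mem_singleton_self c)
    rw [← h1, hbX, hφ, hφ]
    exact hxmem X c hc i j
  have hpd : ∀ c, GramPosDef b (y c) := fun c a ha => by
    rw [apply_linearCombination_eq (hgram c)]
    refine (K c).intForm_pos fun h0 => ha ?_
    have := Fintype.linearIndependent_iff.1 (κ c).linearIndependent a
      (by rwa [Fintype.linearCombination_apply] at h0)
    exact funext this
  obtain ⟨P, ⟨t, rfl⟩, hP⟩ := exists_fg_gramRealized symm nonneg n
  -- Finite generation is used here: agreement on finitely many generators holds for almost all X
  -- and extends bilinearly to the submodule.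
  have hev : ∀ᶠ X in (U : Filter (Finset S)), ∀ u ∈ t, ∀ v ∈ t, bX X u v = b u v := by
    rw [Filter.eventually_all_finset]
    intro u _
    rw [Filter.eventually_all_finset]
    exact fun v _ => hb u v
  obtain ⟨X, hX⟩ := hev.exists
  have hXP : ∀ u ∈ Submodule.span ℤ (t : Set ((S × Fin n) →₀ ℤ)),
      ∀ v ∈ Submodule.span ℤ (t : Set ((S × Fin n) →₀ ℤ)), bX X u v = b u v := by
    intro u hu v hv
    have := apply_eq_zero_of_mem_span (b := bX X - b)
      (fun u hu v hv => by simp [hX u hu v hv]) hu hv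
    simpa [sub_eq_zero] using this
  refine hLS X fun c hc => ?_
  obtain ⟨y', hy'P, hy'⟩ := hP (y ⟨c, hc⟩) (hpd ⟨c, hc⟩)
  refine ⟨K ⟨c, hc⟩, hKcls ⟨c, hc⟩, represents_of_gram (κ ⟨c, hc⟩) (x := fun i => φ X (y' i))
    fun i j => ?_⟩
  rw [← hbX, hXP _ (hy'P i) _ (hy'P j), hy', hgram]

/-- The lattice `N` with its quadratic form multiplied by a positive integer. -/
noncomputable def scaleForm (N : IntegralLattice) (k : ℕ) (hk : 0 < k) : IntegralLattice where
  val :=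
    { V := N.1.V
      Q := (k : ℚ) • N.1.Q
      posDef := fun x hx => by
        have : (0 : ℚ) < k := by exact_mod_cast hk
        simpa using mul_pos this (N.1.posDef x hx)
      L := N.1.L
      fg := N.1.fg }
  property := by
    refine Submodule.span_le.2 ?_
    rintro _ ⟨x, hx, y, hy, rfl⟩
    refine ⟨k * N.intForm ⟨x, hx⟩ ⟨y, hy⟩, ?_⟩
    simp [QLattice.B, intForm_cast]

/-- All norms of the scaled lattice are multiples of k, while x has norm strictly between 0 and k.
-/
theorem cls_scaleForm_ne {N : IntegralLattice} {x : N.1.L} (hx : x ≠ 0) {k : ℕ} (hk : 0 < k)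
    (hxk : N.intForm x x < k) : cls (N.scaleForm k hk) ≠ cls N := by
  intro h
  obtain ⟨e⟩ := (cls_eq_iff _ _).1 h
  let y : N.1.L := e.symm x
  have h1 : N.1.form x = k * N.1.form y := by
    have := e.symm.map_app x
    rw [← this]
    change ((k : ℚ) • N.1.Q) (y : N.1.V) = _
    simp [QLattice.form_apply]
  rw [← intForm_self_cast, ← intForm_self_cast] at h1
  have h2 : N.intForm x x = k * N.intForm y y := by exact_mod_cast h1
  have h3 := N.intForm_pos hx
  have h4 := N.intForm_nonneg y
  rcases h4.eq_or_lt with h5 | h5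
  · rw [← h5] at h2; simp at h2; omega
  · have : (k : ℤ) * 1 ≤ k * N.intForm y y := by gcongr; omega
    omega

end IntegralLattice

theorem proposition2p1 (n : ℕ) (hn : 0 < n) (N : IntegralLattice) (hN : N.1.rank = n) :
    IsExceptionalSet n {cls N} ↔
      ∀ X : Set LatticeClass, IsUniversalityCriterionSet (Phi n) X → cls N ∈ X := by
  have hNPhi : cls N ∈ Phi n := ⟨N, hN, rfl⟩
  constructor
  · rintro ⟨M, -, hM⟩ X ⟨hX, -, hcrit⟩
    by_contra hNX
    have hNM : cls N ∈ exceptionalSet n M := hM ▸ rfl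
    refine hNM.2 (hcrit M (fun c hc => ?_) _ hNPhi)
    by_contra hcM
    have hc' : c ∈ ({cls N} : Set LatticeClass) := hM ▸ (⟨hX hc, hcM⟩ : c ∈ exceptionalSet n M)
    exact hNX (Set.mem_singleton_iff.1 hc' ▸ hc)
  · intro H
    obtain ⟨X, hXS, hXfin, hX⟩ :=
      IntegralLattice.exists_finite_universality_criterion (S := Phi n \ {cls N})
        Set.sdiff_subset
    have hnot : ¬ IsUniversalityCriterionSet (Phi n) X := fun h => (hXS (H X h)).2 rfl
    have hex : ∃ M : IntegralLattice, IsUniversal X M ∧ ¬ IsUniversal (Phi n) M := by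
      by_contra! hcon
      exact hnot ⟨hXS.trans Set.sdiff_subset, hXfin, hcon⟩
    obtain ⟨M, hMX, hMn⟩ := hex
    have hMS := hX M hMX
    have hMN : ¬ RepresentsClass M (cls N) := fun h => hMn fun c hc => by
      by_cases hcN : c = cls N
      · rwa [hcN]
      · exact hMS c ⟨hc, hcN⟩
    refine ⟨M, ?_, ?_⟩
    · have : Nontrivial N.1.L := Module.nontrivial_of_finrank_pos (R := ℤ)
        (hn.trans_eq hN.symm)
      obtain ⟨x, hx⟩ := exists_ne (0 : N.1.L)
      have hpos := N.intForm_pos hx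
      -- Scaling by Q(x) + 1 gives a lattice of rank n not isometric to N, so M represents it.
      have hk : 0 < (N.intForm x x).toNat + 1 := Nat.succ_pos _
      have hne := IntegralLattice.cls_scaleForm_ne hx hk (by omega)
      have hrep := hMS _ ⟨⟨N.scaleForm _ hk, hN, rfl⟩, hne⟩
      rw [representsClass_cls] at hrep
      have hrank : N.1.rank ≤ M.1.rank :=
        IntegralLattice.rank_le_of_represents (K := N.scaleForm _ hk) hrep
      exact hN.symm.le.trans hrank
    · ext c
      constructor
      · rintro ⟨hc, hcM⟩
        by_contra hcN
        exact hcM (hMS c ⟨hc, hcN⟩)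
      · rintro rfl
        exact ⟨hNPhi, hMN⟩
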